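/- **Setting.** Consider $\min_{x\in\mathbb R^n} F(x)=f(x)+h(x)$, where $d\ge 1$, $f:\mathbb R^n\to\mathbb R$ is convex and $d$ times continuously differentiable with $\|\nabla^d f(x)-\nabla^d f(y)\|\le L_d\|x-y\|$ for all $x,y$ (tensor operator norm), $h:\mathbb R^n\to(-\infty,+\infty]$ is proper, closed and convex, and $F$ has a minimizer $x_*$. Let $M>0$, $M\ge L_d\ge 0$, and let $$f_x(y)=\sum_{i=0}^{d}\frac1{i!}\nabla^i f(x)[y-x]^i+\frac{M}{(d+1)!}\|y-x\|^{d+1},$$ where it is assumed that $f_x$ is convex for every $x\in\mathbb R^n$ (so that the subproblems below are strongly convex). Let $\hat\sigma\ge 0$, $0<\sigma_l<\sigma_u<1$, $\sigma:=\hat\sigma+\sigma_u<1$, $\sigma_l(1+\hat\sigma)^{d-1}<\sigma_u(1-\hat\sigma)^{d-1}$, and put $\alpha_+=\frac{d!\,\sigma_u}{L_d+M}$, $\alpha_-=\frac{d!\,\sigma_l}{L_d+M}$. Let $\bar\rho,\bar\epsilon>0$ be tolerances. For $\lambda>0$, a triple $(y,u,\epsilon)$ with $\epsilon\ge0$ is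 a *$\hat\sigma$-approximate solution at $(\lambda,x)$* if $u\in\nabla f_x(y)+\partial_\epsilon h(y)$ and $\|\lambda u+y-x\|^2+2\lambda\epsilon\le\hat\sigma^2\|y-x\|^2$, where $\partial_\epsilon h(y)=\{w: h(z)\ge h(y)+\langle z-y,w\rangle-\epsilon\ \ \forall z\}$. Its residual vector is $v=\nabla f(y)-\nabla f_x(y)+u$. The subroutine ATS returns a $\hat\sigma$-approximate solution at any given $(\lambda,x)$ with $\lambda>0$. **Outer method.** Given $A_k$, $x_k$, $y_k$ (with $A_0=0$, $y_0=x_0$), write $a_k(\lambda)=\frac{\lambda+\sqrt{\lambda^2+4\lambda A_k}}2$ and $\tilde x_k(\lambda)=\frac{A_k}{A_k+a_k(\lambda)}y_k+\frac{a_k(\lambda)}{A_k+a_k(\lambda)}x_k$. Iteration $k$ takes some $\lambda_{k+1}>0$ and a $\hat\sigma$-approximate solution $(y_{k+1},u_{k+1},\epsilon_{k+1})$ at $(\lambda_{k+1},\tilde x_k(\lambda_{k+1}))$, with residual vector $v_{k+1}$, such that $$\text{either}\quad \alpha_-\le\lambda_{k+1}\|y_{k+1}-\tilde x_k(\lambda_{k+1})\|^{d-1}\le\alpha_+\qquad\text{or}\qquad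 \|v_{k+1}\|\le\bar\rho\ \text{ and }\ \epsilon_{k+1}\le\bar\epsilon,$$ and sets $A_{k+1}=A_k+a_k(\lambda_{k+1})$, $x_{k+1}=x_k-a_k(\lambda_{k+1})v_{k+1}$. The method stops at $k\ge1$ if $\|v_k\|\le\bar\rho$ and $\epsilon_k\le\bar\epsilon$. **Bisection on $\beta$ at iteration $k\ge 1$.** Start with $[\beta_-,\beta_+]=[0,1]$. One step: put $\beta=\frac{\beta_-+\beta_+}2$, $\lambda_\beta=A_k\frac{\beta^2}{1-\beta}$, $x_\beta=(1-\beta)y_k+\beta x_k$, call ATS at $(\lambda_\beta,x_\beta)$ to get $(y_\beta,u_\beta,\epsilon_\beta)$, and let $v_\beta$ be its residual vector. If $\|v_\beta\|\le\bar\rho$ and $\epsilon_\beta\le\bar\epsilon$, stop; else if $\lambda_\beta\|y_\beta-x_\beta\|^{d-1}\in[\alpha_-,\alpha_+]$, stop; else if $\lambda_\beta\|y_\beta-x_\beta\|^{d-1}>\alpha_+$, set $\beta_+\leftarrow\beta$; else set $\beta_-\leftarrow\beta$. **Theorem.** Let $D\ge\|x_0-x_*\|$ and $B\ge\|\nabla^\ell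 f(x_*)\|$ for $2\le\ell\le d$. There is a constant $C>0$, depending only on $d,L_d,M,\hat\sigma,\sigma_l,\sigma_u,D,B$ (in particular not on $\bar\epsilon,\bar\rho,k,n$ or the choices made in the method and in ATS), such that, whenever the outer method has reached iteration $k\ge1$ without stopping, the bisection on $\beta$ stops after at most $$C\,\max\{1,\ \log_2(\bar\epsilon^{-1}),\ \log_2(\bar\rho^{-1})\}$$ steps. It then returns either $\lambda_{k+1}>0$ and a $\hat\sigma$-approximate solution $(y_{k+1},u_{k+1},\epsilon_{k+1})$ at $(\lambda_{k+1},\tilde x_k(\lambda_{k+1}))$ with $$\alpha_-\le\lambda_{k+1}\|\tilde x_k(\lambda_{k+1})-y_{k+1}\|^{d-1}\le\alpha_+,$$ or $\lambda_{k+1}>0$ and a $\hat\sigma$-approximate solution at $(\lambda_{k+1},\tilde x_k(\lambda_{k+1}))$ whose residual vector $v_{k+1}$ and $\epsilon_{k+1}$ satisfy $\|v_{k+1}\|\le\bar\rho$ and $\epsilon_{k+1}\le\bar\epsilon$. -/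

import Mathlib

open scoped Nat

noncomputable section

/-- The space `ℝⁿ` with its Euclidean norm and inner product. -/
abbrev Vec (n : ℕ) : Type := EuclideanSpace ℝ (Fin n)

/-! ### The composite problem `min f + h` and its tensor model -/

/-- The regularized `d`-th order Taylor model of `f` at `x`, as a function of `y`:
`f_x(y) = ∑_{i ≤ d} (1/i!) ∇ⁱf(x)[y - x]ⁱ + M/(d+1)! ‖y - x‖^(d+1)`. -/
def tensorModel {n : ℕ} (d : ℕ) (M : ℝ) (f : Vec n → ℝ) (x y : Vec n) : ℝ :=
  (∑ i ∈ Finset.range (d + 1), (1 / (i ! : ℝ)) * iteratedFDeriv ℝ i f x (fun _ => y - x))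
    + M / ((d + 1)! : ℝ) * ‖y - x‖ ^ (d + 1)

/-- `h : ℝⁿ → (-∞, +∞]` is proper, closed (lower semicontinuous) and convex (its epigraph is
convex). -/
structure ProperClosedConvex {n : ℕ} (h : Vec n → EReal) : Prop where
  ne_bot : ∀ x, h x ≠ ⊥
  exists_ne_top : ∃ x, h x ≠ ⊤
  lsc : LowerSemicontinuous h
  convex_epigraph : Convex ℝ {q : Vec n × ℝ | h q.1 ≤ (q.2 : EReal)}

/-- The `ε`-subdifferential `∂_ε h(x)`. -/
def epsSubdifferential {n : ℕ} (h : Vec n → EReal) (ε : ℝ) (x : Vec n) : Set (Vec n) :=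
  {u | ∀ y, h x + ((inner ℝ (y - x) u - ε : ℝ) : EReal) ≤ h y}

/-- `xs` is an optimal solution of `min f + h`. -/
def IsOptimal {n : ℕ} (f : Vec n → ℝ) (h : Vec n → EReal) (xs : Vec n) : Prop :=
  ∀ y, (f xs : EReal) + h xs ≤ (f y : EReal) + h y

/-- `(y, u, ε)` is a `σ`-approximate solution at `(lam, x)` of the subproblem
`min_y f_x(y) + h(y) + ‖y - x‖² / (2 lam)`. -/
structure IsApproxSolution {n : ℕ} (d : ℕ) (M : ℝ) (f : Vec n → ℝ) (h : Vec n → EReal)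
    (σ lam : ℝ) (x y u : Vec n) (ε : ℝ) : Prop where
  lam_pos : 0 < lam
  eps_nonneg : 0 ≤ ε
  inclusion : ∃ w ∈ epsSubdifferential h ε y, u = gradient (tensorModel d M f x) y + w
  error_le : ‖lam • u + y - x‖ ^ 2 + 2 * lam * ε ≤ σ ^ 2 * ‖y - x‖ ^ 2

/-- The residual vector `v = ∇f(y) - ∇f_x(y) + u`. -/
def residualVector {n : ℕ} (d : ℕ) (M : ℝ) (f : Vec n → ℝ) (x y u : Vec n) : Vec n :=
  gradient f y - gradient (tensorModel d M f x) y + u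

/-! ### Input parameters -/

/-- The scalar inputs `d`, `L_d`, `M`, `σ̂`, `σ_l`, `σ_u` of the method. -/
structure MethodInput where
  d : ℕ
  L : ℝ
  M : ℝ
  sigmaHat : ℝ
  sigmaL : ℝ
  sigmaU : ℝ

/-- The requirements on the scalar inputs. -/
structure MethodInput.Admissible (p : MethodInput) : Prop where
  one_le_d : 1 ≤ p.d
  L_nonneg : 0 ≤ p.L
  M_pos : 0 < p.M
  L_le_M : p.L ≤ p.M
  sigmaHat_nonneg : 0 ≤ p.sigmaHat
  sigmaL_pos : 0 < p.sigmaL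
  sigmaL_lt_sigmaU : p.sigmaL < p.sigmaU
  sigmaU_lt_one : p.sigmaU < 1
  sigma_lt_one : p.sigmaHat + p.sigmaU < 1
  gap : p.sigmaL * (1 + p.sigmaHat) ^ (p.d - 1) < p.sigmaU * (1 - p.sigmaHat) ^ (p.d - 1)

/-- `α₊ = d! σ_u / (L_d + M)`. -/
def MethodInput.alphaPlus (p : MethodInput) : ℝ := (p.d ! : ℝ) * p.sigmaU / (p.L + p.M)

/-- `α₋ = d! σ_l / (L_d + M)`. -/
def MethodInput.alphaMinus (p : MethodInput) : ℝ := (p.d ! : ℝ) * p.sigmaL / (p.L + p.M)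

/-- The standing assumptions on the problem: `f` is convex and `d` times continuously
differentiable with `L_d`-Lipschitz `d`-th derivative (in the tensor operator norm), `h` is proper
closed convex, and all regularized Taylor models `f_x` are convex. -/
structure IsCompositeProblem {n : ℕ} (p : MethodInput) (f : Vec n → ℝ) (h : Vec n → EReal) :
    Prop where
  smooth : ContDiff ℝ p.d f
  convex : ConvexOn ℝ Set.univ f
  lipschitz : ∀ x y, ‖iteratedFDeriv ℝ p.d f x - iteratedFDeriv ℝ p.d f y‖ ≤ p.L * ‖x - y‖
  closed_convex : ProperClosedConvex h
  model_convex : ∀ x, ConvexOn ℝ Set.univ (tensorModel p.d p.M f x)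

/-! ### The outer method -/

/-- `a(lam) = (lam + √(lam² + 4 lam A)) / 2`. -/
def stepWeight (A lam : ℝ) : ℝ := (lam + √(lam ^ 2 + 4 * lam * A)) / 2

/-- `x̃(lam) = A/(A + a) y + a/(A + a) x` with `a = a(lam)`. -/
def extrapolated {n : ℕ} (A : ℝ) (x y : Vec n) (lam : ℝ) : Vec n :=
  (A / (A + stepWeight A lam)) • y + (stepWeight A lam / (A + stepWeight A lam)) • x

/-- The sequences produced by the outer method; `eps j` is `ε_j`. -/
structure OuterSequences (n : ℕ) where
  A : ℕ → ℝ
  lam : ℕ → ℝ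
  x : ℕ → Vec n
  y : ℕ → Vec n
  u : ℕ → Vec n
  v : ℕ → Vec n
  eps : ℕ → ℝ

/-- `s` records a run of the outer (optimal tensor) method started at `x₀`, with tolerances
`rho` and `epsTol`, that has completed iterations `0, …, k - 1` and has not stopped at the test made
at the beginning of iteration `k`. Any `lam (j+1)` and any approximate solution that satisfy the
requirements of the method are allowed. (The stopping test of iteration `0`, which only concerns
a vector `v₀` used nowhere else, is not imposed.) -/
structure IsOuterRun {n : ℕ} (p : MethodInput) (f : Vec n → ℝ) (h : Vec n → EReal) (x₀ : Vec n)
    (rho epsTol : ℝ) (k : ℕ) (s : OuterSequences n) : Prop where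
  A_zero : s.A 0 = 0
  x_zero : s.x 0 = x₀
  y_zero : s.y 0 = x₀
  approx : ∀ j < k, IsApproxSolution p.d p.M f h p.sigmaHat (s.lam (j + 1))
    (extrapolated (s.A j) (s.x j) (s.y j) (s.lam (j + 1))) (s.y (j + 1)) (s.u (j + 1))
    (s.eps (j + 1))
  v_succ : ∀ j < k, s.v (j + 1) = residualVector p.d p.M f
    (extrapolated (s.A j) (s.x j) (s.y j) (s.lam (j + 1))) (s.y (j + 1)) (s.u (j + 1))
  accept : ∀ j < k,
    s.lam (j + 1) * ‖s.y (j + 1) - extrapolated (s.A j) (s.x j) (s.y j) (s.lam (j + 1))‖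
        ^ (p.d - 1) ∈ Set.Icc p.alphaMinus p.alphaPlus
      ∨ (‖s.v (j + 1)‖ ≤ rho ∧ s.eps (j + 1) ≤ epsTol)
  A_succ : ∀ j < k, s.A (j + 1) = s.A j + stepWeight (s.A j) (s.lam (j + 1))
  x_succ : ∀ j < k, s.x (j + 1) = s.x j - stepWeight (s.A j) (s.lam (j + 1)) • s.v (j + 1)
  not_stopped : ∀ j, 1 ≤ j → j ≤ k → ¬ (‖s.v j‖ ≤ rho ∧ s.eps j ≤ epsTol)

/-! ### The approximate tensor subroutine and the bisection on `β` -/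

/-- What the approximate tensor subroutine returns at `(lam, x)`. -/
structure SubroutineOutput (n : ℕ) where
  y : Vec n
  u : Vec n
  eps : ℝ

/-- `ats` is an approximate tensor subroutine: for all `lam > 0` and `x` it returns
a `σ̂`-approximate solution at `(lam, x)`. -/
def IsSubroutine {n : ℕ} (p : MethodInput) (f : Vec n → ℝ) (h : Vec n → EReal)
    (ats : ℝ → Vec n → SubroutineOutput n) : Prop :=
  ∀ lam x, 0 < lam →
    IsApproxSolution p.d p.M f h p.sigmaHat lam x (ats lam x).y (ats lam x).u (ats lam x).eps

/-- The quantities `β, λ_β, x_β, y_β, u_β, v_β, ε_β` computed in one bisection step. -/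
structure Trial (n : ℕ) where
  beta : ℝ
  lam : ℝ
  x : Vec n
  y : Vec n
  u : Vec n
  v : Vec n
  eps : ℝ

/-- One call of the subroutine at `λ_β = A β² / (1 - β)` and `x_β = (1 - β) y + β x`. -/
def trial {n : ℕ} (p : MethodInput) (f : Vec n → ℝ) (ats : ℝ → Vec n → SubroutineOutput n)
    (A : ℝ) (x y : Vec n) (β : ℝ) : Trial n :=
  let lam := A * (β ^ 2 / (1 - β))
  let xβ := (1 - β) • y + β • x
  let o := ats lam xβ
  { beta := β, lam := lam, x := xβ, y := o.y, u := o.u,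
    v := residualVector p.d p.M f xβ o.y o.u, eps := o.eps }

/-- State of the bisection: still searching in `[β₋, β₊]`, or stopped with one of the two kinds
of output. -/
inductive BisectionState (n : ℕ) : Type
  | searching (betaMinus betaPlus : ℝ) : BisectionState n
  | smallResidual (t : Trial n) : BisectionState n
  | largeStep (t : Trial n) : BisectionState n

open Classical in
/-- One bisection step (one call of the subroutine); stopped states do not change. -/
def bisectionStep {n : ℕ} (p : MethodInput) (f : Vec n → ℝ)
    (ats : ℝ → Vec n → SubroutineOutput n) (A : ℝ) (x y : Vec n) (rho epsTol : ℝ) :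
    BisectionState n → BisectionState n
  | .searching βm βp =>
      let β := (βm + βp) / 2
      let t := trial p f ats A x y β
      if ‖t.v‖ ≤ rho ∧ t.eps ≤ epsTol then .smallResidual t
      else if t.lam * ‖t.y - t.x‖ ^ (p.d - 1) ∈ Set.Icc p.alphaMinus p.alphaPlus then .largeStep t
      else if p.alphaPlus < t.lam * ‖t.y - t.x‖ ^ (p.d - 1) then .searching βm β
      else .searching β βp
  | .smallResidual t => .smallResidual t
  | .largeStep t => .largeStep t

/-- The state of the bisection, started from `[0, 1]`, after `N` bisection steps. -/
def bisection {n : ℕ} (p : MethodInput) (f : Vec n → ℝ)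
    (ats : ℝ → Vec n → SubroutineOutput n) (A : ℝ) (x y : Vec n) (rho epsTol : ℝ) (N : ℕ) :
    BisectionState n :=
  (bisectionStep p f ats A x y rho epsTol)^[N] (.searching 0 1)

/-- The trial `t` is a `σ̂`-approximate solution at `(λ, x̃(λ))` for its own `λ > 0`, and `t.v` is
its residual vector. -/
def Trial.IsValid {n : ℕ} (p : MethodInput) (f : Vec n → ℝ) (h : Vec n → EReal) (A : ℝ)
    (x y : Vec n) (t : Trial n) : Prop :=
  IsApproxSolution p.d p.M f h p.sigmaHat t.lam (extrapolated A x y t.lam) t.y t.u t.eps ∧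
    t.v = residualVector p.d p.M f (extrapolated A x y t.lam) t.y t.u

end

/-!
The bisection searches for a `β` at which the criterion `λ_β ‖y_β - x_β‖^(d-1)` lies in
`[α₋, α₊]`. If it is still searching after `N` steps, it holds a bracket `[β₋, β₊]` of length
`2^(-N)` whose ends lie on different sides of this interval (or are `0` and `1`). The proof shows
that such a bracket cannot be shorter than a fixed power of `1 / W`, where `W` is a constant times
`1 / min(1/2, ε̄, ρ̄)`; taking logarithms gives the bound (`one_lt_bracket_mul_pow`).

*The outer method.* A run that has not stopped has accepted only steps with
`λ ‖y - x̃‖^(d-1) ∈ [α₋, α₊]`. By Taylor's theorem these satisfy the relative error criterion of a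
hybrid proximal extragradient method for `f + h` (`IsApproxSolution.residual_error_le`), and the
usual energy estimate bounds the distances of `x_k` and `y_k` to a minimizer `x_*`
(`IsOuterRun.outerInvariant`). It also gives `A_k / λ_k ‖y_k - x̃‖² = O(1)`. As the residual at `k`
is not small, this forces `A_k` to be at most polynomial in the inverse tolerances
(`IsOuterRun.A_mul_sq_le`), whatever `k` is.

*The ends of the bracket.* If `β₋` is near `1`, then `λ` is large; a trial below `α₋` is
a relative-error step for `f + h`, so that its residual is `O(1 / λ)` and the bisection would have
stopped. If `β₊` is near `0`, then `λ` is small; the step lengths being `O(1 + λ)`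
(`IsApproxSolution.step_le_stepFactor`), the criterion could not exceed `α₊`. The bound on the step
length uses that `∇f_x(x_*) - ∇f(x_*)`, which Taylor's theorem bounds, belongs to
`(∇f_x + ∂h)(x_*)`.

*Between the ends.* Comparing the two trials by monotonicity of `∇f_x + ∂_ε h` gives
`(1 - σ̂) r₊ ≤ (1 + σ̂) r₋ + O(β₊ - β₋)` for the step lengths `r₋, r₊`, with a constant polynomial
in `W` (`IsApproxSolution.one_sub_mul_step_le`). Since `α₊ (1 - σ̂)^(d-1) > α₋ (1 + σ̂)^(d-1)`, the
two ends cannot lie on different sides of `[α₋, α₊]` when `β₊ - β₋` is small. The comparison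
requires that the gradient of the Taylor polynomial depend on the base point in a Lipschitz way;
the Lipschitz condition on the `d`-th derivative alone provides this
(`norm_taylorPoly_sub_taylorPoly_le`).
-/

/-! ### Taylor polynomials with values in a normed space -/

universe u

section Taylor

variable {E F : Type u} [NormedAddCommGroup E] [NormedSpace ℝ E] [NormedAddCommGroup F]
  [NormedSpace ℝ F]

/-- The Taylor polynomial of degree `m` of `g` at `x`, as a function of `y`. -/
noncomputable def taylorPoly (m : ℕ) (g : E → F) (x y : E) : F :=
  ∑ i ∈ Finset.range (m + 1), (1 / (i ! : ℝ)) • iteratedFDeriv ℝ i g x (fun _ => y - x)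

theorem taylorPoly_self (m : ℕ) (g : E → F) (x : E) : taylorPoly m g x x = g x := by
  have h0 : ∀ i : ℕ, iteratedFDeriv ℝ (i + 1) g x (fun _ => (0 : E)) = 0 := fun i =>
    ContinuousMultilinearMap.map_coord_zero _ 0 rfl
  simp [taylorPoly, Finset.sum_range_succ' _ m, h0]

theorem iteratedFDeriv_succ_apply_diag (i : ℕ) (g : E → F) (x z : E) :
    iteratedFDeriv ℝ (i + 1) g x (fun _ => z) =
      iteratedFDeriv ℝ i (fderiv ℝ g) x (fun _ => z) z := by
  rw [iteratedFDeriv_succ_apply_right]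
  rfl

/-- Symmetry in the two last arguments, the only case of the symmetry of higher derivatives that
differentiating a Taylor polynomial requires. -/
theorem iteratedFDeriv_fderiv_fderiv_symm {i : ℕ} {g : E → F} (hg : ContDiff ℝ (i + 2 : ℕ) g)
    (x z ξ η : E) :
    iteratedFDeriv ℝ i (fderiv ℝ (fderiv ℝ g)) x (fun _ => z) ξ η =
      iteratedFDeriv ℝ i (fderiv ℝ (fderiv ℝ g)) x (fun _ => z) η ξ := by
  have h1 : ContDiff ℝ (i + 1 : ℕ) (fderiv ℝ g) := by
    apply hg.fderiv_right
    norm_cast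
  have h2 : ContDiff ℝ (i : ℕ) (fderiv ℝ (fderiv ℝ g)) := by
    apply h1.fderiv_right
    norm_cast
  have hsymm : ∀ w, (fderiv ℝ (fderiv ℝ g) w).flip = fderiv ℝ (fderiv ℝ g) w := by
    intro w
    have hw : ContDiffAt ℝ 2 g w := hg.contDiffAt.of_le (by norm_cast; omega)
    have := hw.isSymmSndFDerivAt (by simp)
    ext a b
    exact this b a
  let flip : (E →L[ℝ] E →L[ℝ] F) →L[ℝ] (E →L[ℝ] E →L[ℝ] F) :=
    (ContinuousLinearMap.flipₗᵢ ℝ E E F).toContinuousLinearEquiv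
  have hcomp := ContinuousLinearMap.iteratedFDeriv_comp_left (G := E →L[ℝ] E →L[ℝ] F) flip
      (h2.contDiffAt (x := x)) (i := i) le_rfl
  have hfun : flip ∘ fderiv ℝ (fderiv ℝ g) = fderiv ℝ (fderiv ℝ g) := by
    funext w
    exact hsymm w
  rw [hfun] at hcomp
  conv_lhs => rw [hcomp]
  rfl

theorem hasFDerivAt_iteratedFDeriv_diag (i : ℕ) :
    ∀ {F : Type u} [NormedAddCommGroup F] [NormedSpace ℝ F] {g : E → F},
      ContDiff ℝ (i + 1 : ℕ) g → ∀ x z : E,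
      HasFDerivAt (fun z => iteratedFDeriv ℝ (i + 1) g x (fun _ => z))
        (((i : ℝ) + 1) • iteratedFDeriv ℝ i (fderiv ℝ g) x (fun _ => z)) z := by
  induction i with
  | zero =>
    intro F _ _ g hg x z
    have hfun : (fun z => iteratedFDeriv ℝ (0 + 1) g x (fun _ => z)) = fderiv ℝ g x := by
      funext z
      exact iteratedFDeriv_one_apply _
    rw [hfun]
    simpa using (fderiv ℝ g x).hasFDerivAt
  | succ i ih =>
    intro F _ _ g hg x z
    have h1 : ContDiff ℝ (i + 1 : ℕ) (fderiv ℝ g) := by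
      apply hg.fderiv_right
      norm_cast
    have key := (ih h1 x z).clm_apply (hasFDerivAt_id z)
    have hfun : (fun z => iteratedFDeriv ℝ (i + 1 + 1) g x (fun _ => z)) =
        fun z => iteratedFDeriv ℝ (i + 1) (fderiv ℝ g) x (fun _ => z) (id z) := by
      funext z
      exact iteratedFDeriv_succ_apply_diag (i + 1) g x z
    rw [hfun]
    refine key.congr_fderiv ?_
    ext ξ
    have hs := iteratedFDeriv_fderiv_fderiv_symm hg x z ξ z
    have hd := iteratedFDeriv_succ_apply_diag i (fderiv ℝ g) x z
    simp only [add_apply, ContinuousLinearMap.comp_apply,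
      ContinuousLinearMap.flip_apply, smul_apply, id,
      ContinuousLinearMap.id_apply, hs, hd, Nat.cast_add, Nat.cast_one]
    module

theorem hasFDerivAt_taylorPoly {m : ℕ} {g : E → F} (hg : ContDiff ℝ (m + 1 : ℕ) g) (x y : E) :
    HasFDerivAt (taylorPoly (m + 1) g x) (taylorPoly m (fderiv ℝ g) x y) y := by
  have hsum : taylorPoly (m + 1) g x = fun y =>
      (∑ i ∈ Finset.range (m + 1),
        (1 / ((i + 1) ! : ℝ)) • iteratedFDeriv ℝ (i + 1) g x (fun _ => y - x)) + g x := by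
    funext y
    simp [taylorPoly, Finset.sum_range_succ' _ (m + 1)]
  rw [hsum]
  refine HasFDerivAt.add_const _ ?_
  refine HasFDerivAt.fun_sum fun i hi => ?_
  have hi' : i + 1 ≤ m + 1 := by simpa using hi
  have hgi : ContDiff ℝ (i + 1 : ℕ) g := hg.of_le (by exact_mod_cast hi')
  have h := ((hasFDerivAt_iteratedFDeriv_diag i hgi x (y - x)).comp y
    ((hasFDerivAt_id y).sub_const x)).const_smul (1 / ((i + 1) ! : ℝ))
  refine h.congr_fderiv ?_
  rw [ContinuousLinearMap.comp_id, smul_smul]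
  congr 1
  rw [Nat.factorial_succ]
  push_cast
  field_simp

theorem norm_le_of_norm_fderiv_le_pow {ψ : E → F} {ψ' : E → E →L[ℝ] F} {x : E} {c : ℝ} {k : ℕ}
    (hψ : ∀ y, HasFDerivAt ψ (ψ' y) y) (hx : ψ x = 0) (hb : ∀ y, ‖ψ' y‖ ≤ c * ‖y - x‖ ^ k) (y : E) :
    ‖ψ y‖ ≤ c / (k + 1) * ‖y - x‖ ^ (k + 1) := by
  have hd : ∀ t : ℝ,
      HasDerivAt (fun t : ℝ => ψ (x + t • (y - x))) (ψ' (x + t • (y - x)) (y - x)) t := by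
    intro t
    have h1 : HasDerivAt (fun t : ℝ => x + t • (y - x)) (y - x) t := by
      simpa using ((hasDerivAt_id t).smul_const (y - x)).const_add x
    exact (hψ _).comp_hasDerivAt t h1
  have hB : ∀ t : ℝ, HasDerivAt (fun t : ℝ => c / (k + 1) * ‖y - x‖ ^ (k + 1) * t ^ (k + 1))
      (c * ‖y - x‖ ^ (k + 1) * t ^ k) t := by
    intro t
    have := (hasDerivAt_pow (k + 1) t).const_mul (c / (k + 1) * ‖y - x‖ ^ (k + 1))
    refine this.congr_deriv ?_
    have : (k : ℝ) + 1 ≠ 0 := by positivity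
    rw [Nat.add_sub_cancel]
    push_cast
    field_simp
  have := image_norm_le_of_norm_deriv_right_le_deriv_boundary (a := 0) (b := 1)
    (f := fun t : ℝ => ψ (x + t • (y - x))) (f' := fun t => ψ' (x + t • (y - x)) (y - x))
    (B := fun t : ℝ => c / (k + 1) * ‖y - x‖ ^ (k + 1) * t ^ (k + 1))
    (B' := fun t : ℝ => c * ‖y - x‖ ^ (k + 1) * t ^ k)
    (fun t _ => (hd t).continuousAt.continuousWithinAt) (fun t _ => (hd t).hasDerivWithinAt)
    (by simp [hx]) hB ?_ (x := 1) (by simp)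
  · simpa using this
  · intro t ht
    refine (ContinuousLinearMap.le_opNorm _ _).trans ?_
    have := hb (x + t • (y - x))
    rw [add_sub_cancel_left, norm_smul, Real.norm_of_nonneg ht.1] at this
    calc _ ≤ c * (t * ‖y - x‖) ^ k * ‖y - x‖ := by gcongr
      _ = _ := by ring

theorem norm_iteratedFDeriv_fderiv_sub (m : ℕ) (g : E → F) (x y : E) :
    ‖iteratedFDeriv ℝ m (fderiv ℝ g) x - iteratedFDeriv ℝ m (fderiv ℝ g) y‖ =
      ‖iteratedFDeriv ℝ (m + 1) g x - iteratedFDeriv ℝ (m + 1) g y‖ := by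
  rw [iteratedFDeriv_succ_eq_comp_right, iteratedFDeriv_succ_eq_comp_right, ← dist_eq_norm,
    ← dist_eq_norm]
  exact ((continuousMultilinearCurryRightEquiv' ℝ m E F).symm.isometry.dist_eq _ _).symm

theorem norm_sub_le_of_iteratedFDeriv_zero {g : E → F} {L : ℝ}
    (hL : ∀ a b, ‖iteratedFDeriv ℝ 0 g a - iteratedFDeriv ℝ 0 g b‖ ≤ L * ‖a - b‖) (a b : E) :
    ‖g a - g b‖ ≤ L * ‖a - b‖ := by
  have := hL a b
  rwa [iteratedFDeriv_zero_eq_comp, Function.comp_apply, Function.comp_apply, ← map_sub,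
    LinearIsometryEquiv.norm_map] at this

/-- Taylor's theorem with Lipschitz highest derivative, by induction on the degree: the derivative
of the remainder of `g` is the remainder of `fderiv ℝ g`. -/
theorem norm_sub_taylorPoly_le (m : ℕ) :
    ∀ {F : Type u} [NormedAddCommGroup F] [NormedSpace ℝ F] {g : E → F} {L : ℝ},
      ContDiff ℝ m g →
      (∀ a b, ‖iteratedFDeriv ℝ m g a - iteratedFDeriv ℝ m g b‖ ≤ L * ‖a - b‖) →
      ∀ x y, ‖g y - taylorPoly m g x y‖ ≤ L / (m + 1)! * ‖y - x‖ ^ (m + 1) := by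
  induction m with
  | zero =>
    intro F _ _ g L _ hL x y
    simpa [taylorPoly] using norm_sub_le_of_iteratedFDeriv_zero hL y x
  | succ m ih =>
    intro F _ _ g L hg hL x y
    have h1 : ContDiff ℝ (m : ℕ) (fderiv ℝ g) := by
      apply hg.fderiv_right
      norm_cast
    have hb := ih h1 (L := L) (fun a b => by
      rw [norm_iteratedFDeriv_fderiv_sub]; exact hL a b) x
    have hd : ∀ y, HasFDerivAt (fun y => g y - taylorPoly (m + 1) g x y)
        (fderiv ℝ g y - taylorPoly m (fderiv ℝ g) x y) y := fun y =>
      ((hg.differentiable (by simp)).differentiableAt.hasFDerivAt).sub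
        (hasFDerivAt_taylorPoly hg x y)
    have := norm_le_of_norm_fderiv_le_pow hd ?_ hb y
    · refine this.trans (le_of_eq ?_)
      rw [Nat.factorial_succ (m + 1)]
      push_cast
      field_simp
    · simp [taylorPoly_self]

/-- Dependence of the Taylor polynomial on the base point. The induction uses that
`taylorPoly (m + 1) g x₁ - taylorPoly (m + 1) g x₂` is, at `x₂`, a Taylor remainder, and has
the corresponding difference for `fderiv ℝ g` as derivative; so no bound on the derivatives
of `g` is required. -/
theorem norm_taylorPoly_sub_taylorPoly_le (m : ℕ) :
    ∀ {F : Type u} [NormedAddCommGroup F] [NormedSpace ℝ F] {g : E → F} {L : ℝ}, 0 ≤ L →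
      ContDiff ℝ m g →
      (∀ a b, ‖iteratedFDeriv ℝ m g a - iteratedFDeriv ℝ m g b‖ ≤ L * ‖a - b‖) →
      ∀ {x₁ x₂ y : E} {R : ℝ}, ‖x₁ - x₂‖ ≤ 1 → ‖y - x₂‖ ≤ R →
        ‖taylorPoly m g x₁ y - taylorPoly m g x₂ y‖ ≤ L * ‖x₁ - x₂‖ * (1 + R) ^ m := by
  induction m with
  | zero =>
    intro F _ _ g L _ _ hL x₁ x₂ y R _ _
    simpa [taylorPoly] using norm_sub_le_of_iteratedFDeriv_zero hL x₁ x₂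
  | succ m ih =>
    intro F _ _ g L hL0 hg hL x₁ x₂ y R hx hy
    have hR : 0 ≤ R := (norm_nonneg _).trans hy
    have h1 : ContDiff ℝ (m : ℕ) (fderiv ℝ g) := by
      apply hg.fderiv_right
      norm_cast
    have hL1 : ∀ a b, ‖iteratedFDeriv ℝ m (fderiv ℝ g) a - iteratedFDeriv ℝ m (fderiv ℝ g) b‖
        ≤ L * ‖a - b‖ := fun a b => by
      rw [norm_iteratedFDeriv_fderiv_sub]; exact hL a b
    set ψ : E → F := fun y => taylorPoly (m + 1) g x₁ y - taylorPoly (m + 1) g x₂ y with hψ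
    have hd : ∀ y, HasFDerivAt ψ
        (taylorPoly m (fderiv ℝ g) x₁ y - taylorPoly m (fderiv ℝ g) x₂ y) y := fun y =>
      (hasFDerivAt_taylorPoly hg x₁ y).sub (hasFDerivAt_taylorPoly hg x₂ y)
    have hmv : ‖ψ y - ψ x₂‖ ≤ L * ‖x₁ - x₂‖ * (1 + R) ^ m * ‖y - x₂‖ :=
      (convex_closedBall x₂ R).norm_image_sub_le_of_norm_hasFDerivWithin_le
        (fun z _ => (hd z).hasFDerivWithinAt)
        (fun z hz => ih hL0 h1 hL1 hx (by simpa [dist_eq_norm] using hz))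
        (by simpa using hR) (by simpa [dist_eq_norm] using hy)
    have hx2 : ‖ψ x₂‖ ≤ L * ‖x₁ - x₂‖ := by
      have h3 := norm_sub_taylorPoly_le (m + 1) hg hL x₁ x₂
      rw [hψ]
      simp only [taylorPoly_self]
      rw [norm_sub_rev]
      refine h3.trans ?_
      rw [norm_sub_rev x₂ x₁, pow_succ]
      have h4 : L / ((m + 1 + 1)! : ℝ) ≤ L :=
        div_le_self hL0 (by exact_mod_cast Nat.one_le_iff_ne_zero.mpr (Nat.factorial_ne_zero _))
      have h5 : ‖x₁ - x₂‖ ^ (m + 1) ≤ 1 := pow_le_one₀ (norm_nonneg _) hx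
      calc L / ((m + 1 + 1)! : ℝ) * (‖x₁ - x₂‖ ^ (m + 1) * ‖x₁ - x₂‖)
          ≤ L * (1 * ‖x₁ - x₂‖) := by gcongr
        _ = _ := by ring
    have h6 : (1 : ℝ) ≤ (1 + R) ^ m := one_le_pow₀ (by linarith)
    calc ‖ψ y‖ ≤ ‖ψ y - ψ x₂‖ + ‖ψ x₂‖ := by
          simpa using norm_add_le (ψ y - ψ x₂) (ψ x₂)
      _ ≤ L * ‖x₁ - x₂‖ * (1 + R) ^ m * R + L * ‖x₁ - x₂‖ * (1 + R) ^ m := by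
          refine add_le_add (hmv.trans ?_) (hx2.trans ?_)
          · gcongr
          · exact le_mul_of_one_le_right (by positivity) h6
      _ = _ := by ring

end Taylor

/-! ### The gradient of the tensor model -/

section Model

variable {n : ℕ}

/-- The gradient of the regularization term, up to a constant. -/
theorem hasFDerivAt_norm_pow_add_two {E : Type*} [NormedAddCommGroup E] [InnerProductSpace ℝ E]
    (m : ℕ) (x y : E) :
    HasFDerivAt (fun y => ‖y - x‖ ^ (m + 2))
      (((m : ℝ) + 2) • innerSL ℝ (‖y - x‖ ^ m • (y - x))) y := by
  have h := (hasFDerivAt_norm_rpow (y - x) (p := ((m + 2 : ℕ) : ℝ))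
    (by push_cast; have : (0 : ℝ) ≤ m := m.cast_nonneg; linarith)).comp y
    ((hasFDerivAt_id y).sub_const x)
  have hp : ((m + 2 : ℕ) : ℝ) - 2 = m := by push_cast; ring
  rw [hp, ContinuousLinearMap.comp_id] at h
  simp only [Function.comp_def, Real.rpow_natCast, id] at h
  refine h.congr_fderiv ?_
  rw [map_smul, smul_smul]
  push_cast
  rfl

theorem norm_pow_smul_sub_le {E : Type*} [NormedAddCommGroup E] [NormedSpace ℝ E] {a b : E} {Q : ℝ}
    (ha : ‖a‖ ≤ Q) (hb : ‖b‖ ≤ Q) (m : ℕ) :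
    ‖‖a‖ ^ m • a - ‖b‖ ^ m • b‖ ≤ (m + 1) * Q ^ m * ‖a - b‖ := by
  have hQ : 0 ≤ Q := (norm_nonneg a).trans ha
  induction m with
  | zero => simp
  | succ m ih =>
    have h1 : ‖a‖ ^ (m + 1) • a - ‖b‖ ^ (m + 1) • b =
        ‖a‖ • (‖a‖ ^ m • a - ‖b‖ ^ m • b) + (‖a‖ - ‖b‖) • (‖b‖ ^ m • b) := by
      rw [pow_succ, pow_succ]
      module
    rw [h1]
    calc _ ≤ ‖a‖ * ‖‖a‖ ^ m • a - ‖b‖ ^ m • b‖ + |‖a‖ - ‖b‖| * (‖b‖ ^ m * ‖b‖) := by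
          refine (norm_add_le _ _).trans ?_
          simp [norm_smul]
      _ ≤ Q * ((m + 1) * Q ^ m * ‖a - b‖) + ‖a - b‖ * (Q ^ m * Q) := by
          gcongr
          exact abs_norm_sub_norm_le a b
      _ = _ := by push_cast; ring

theorem hasFDerivAt_tensorModel {m : ℕ} {f : Vec n → ℝ} (hf : ContDiff ℝ (m + 1 : ℕ) f) (M : ℝ)
    (x y : Vec n) :
    HasFDerivAt (tensorModel (m + 1) M f x)
      (taylorPoly m (fderiv ℝ f) x y
        + (M / ((m + 1)! : ℝ)) • innerSL ℝ (‖y - x‖ ^ m • (y - x))) y := by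
  have h := (hasFDerivAt_taylorPoly hf x y).add
    ((hasFDerivAt_norm_pow_add_two m x y).const_mul (M / ((m + 1 + 1)! : ℝ)))
  refine h.congr_fderiv ?_
  rw [smul_smul]
  congr 2
  rw [Nat.factorial_succ (m + 1)]
  push_cast
  field_simp
  ring

theorem differentiable_tensorModel {d : ℕ} (hd : 1 ≤ d) {f : Vec n → ℝ} (hf : ContDiff ℝ d f)
    (M : ℝ) (x : Vec n) : Differentiable ℝ (tensorModel d M f x) := by
  obtain ⟨m, rfl⟩ := Nat.exists_eq_succ_of_ne_zero (by omega : d ≠ 0)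
  exact fun y => (hasFDerivAt_tensorModel hf M x y).differentiableAt

theorem norm_gradient_sub_gradient {E : Type*} [NormedAddCommGroup E] [InnerProductSpace ℝ E]
    [CompleteSpace E] (f g : E → ℝ) (y : E) :
    ‖gradient f y - gradient g y‖ = ‖fderiv ℝ f y - fderiv ℝ g y‖ := by
  rw [gradient, gradient, ← map_sub, LinearIsometryEquiv.norm_map]

theorem norm_gradient_sub_gradient_tensorModel_le {d : ℕ} (hd : 1 ≤ d) {f : Vec n → ℝ} {L M : ℝ}
    (hM : 0 ≤ M) (hf : ContDiff ℝ d f)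
    (hL : ∀ a b, ‖iteratedFDeriv ℝ d f a - iteratedFDeriv ℝ d f b‖ ≤ L * ‖a - b‖) (x y : Vec n) :
    ‖gradient f y - gradient (tensorModel d M f x) y‖ ≤ (L + M) / (d ! : ℝ) * ‖y - x‖ ^ d := by
  obtain ⟨m, rfl⟩ := Nat.exists_eq_succ_of_ne_zero (by omega : d ≠ 0)
  have h1 : ContDiff ℝ (m : ℕ) (fderiv ℝ f) := by
    apply hf.fderiv_right
    norm_cast
  have h2 := norm_sub_taylorPoly_le m h1 (L := L) (fun a b => by
    rw [norm_iteratedFDeriv_fderiv_sub]; exact hL a b) x y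
  rw [norm_gradient_sub_gradient, (hasFDerivAt_tensorModel hf M x y).fderiv, ← sub_sub]
  refine (norm_sub_le _ _).trans ?_
  rw [norm_smul, innerSL_apply_norm, norm_smul, Real.norm_of_nonneg (by positivity), norm_pow,
    norm_norm]
  calc _ ≤ L / ((m + 1)! : ℝ) * ‖y - x‖ ^ (m + 1)
        + M / ((m + 1)! : ℝ) * (‖y - x‖ ^ m * ‖y - x‖) := by gcongr
    _ = _ := by rw [Nat.succ_eq_add_one]; ring

theorem norm_gradient_tensorModel_sub_le {d : ℕ} (hd : 1 ≤ d) {f : Vec n → ℝ} {L M : ℝ}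
    (hL0 : 0 ≤ L) (hM : 0 ≤ M) (hf : ContDiff ℝ d f)
    (hL : ∀ a b, ‖iteratedFDeriv ℝ d f a - iteratedFDeriv ℝ d f b‖ ≤ L * ‖a - b‖)
    {x₁ x₂ y : Vec n} {R : ℝ} (hx : ‖x₁ - x₂‖ ≤ 1) (hy : ‖y - x₂‖ ≤ R) :
    ‖gradient (tensorModel d M f x₁) y - gradient (tensorModel d M f x₂) y‖
      ≤ (L + d * M) * ‖x₁ - x₂‖ * (1 + R) ^ (d - 1) := by
  obtain ⟨m, rfl⟩ := Nat.exists_eq_succ_of_ne_zero (by omega : d ≠ 0)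
  have h1 : ContDiff ℝ (m : ℕ) (fderiv ℝ f) := by
    apply hf.fderiv_right
    norm_cast
  have h2 := norm_taylorPoly_sub_taylorPoly_le m hL0 h1 (fun a b => by
    rw [norm_iteratedFDeriv_fderiv_sub]; exact hL a b) hx hy
  have h3 : ‖y - x₁‖ ≤ 1 + R := by
    have : y - x₁ = (y - x₂) - (x₁ - x₂) := by abel
    rw [this]
    linarith [norm_sub_le (y - x₂) (x₁ - x₂)]
  have h4 := norm_pow_smul_sub_le h3 (hy.trans (by linarith) : ‖y - x₂‖ ≤ 1 + R) m
  rw [norm_gradient_sub_gradient, (hasFDerivAt_tensorModel hf M x₁ y).fderiv,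
    (hasFDerivAt_tensorModel hf M x₂ y).fderiv, add_sub_add_comm, ← smul_sub, ← map_sub]
  refine (norm_add_le _ _).trans ?_
  rw [norm_smul, innerSL_apply_norm, Real.norm_of_nonneg (by positivity)]
  have h5 : y - x₁ - (y - x₂) = -(x₁ - x₂) := by abel
  rw [h5, norm_neg] at h4
  have h6 : M / ((m + 1)! : ℝ) ≤ M :=
    div_le_self hM (by exact_mod_cast Nat.one_le_iff_ne_zero.mpr (Nat.factorial_ne_zero _))
  have hR : 0 ≤ R := (norm_nonneg _).trans hy
  calc _ ≤ L * ‖x₁ - x₂‖ * (1 + R) ^ m + M * ((m + 1) * (1 + R) ^ m * ‖x₁ - x₂‖) := by gcongr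
    _ = _ := by rw [Nat.succ_eq_add_one, Nat.add_sub_cancel]; push_cast; ring

end Model

/-! ### Convex analysis -/

theorem le_of_hasDerivAt_of_forall_mul_le {g : ℝ → ℝ} {g' c : ℝ} (hg : HasDerivAt g g' 0)
    (h : ∀ t : ℝ, 0 < t → t ≤ 1 → t * c ≤ g t - g 0) : c ≤ g' := by
  have h1 := hg.tendsto_slope_zero_right
  refine ge_of_tendsto h1 ?_
  filter_upwards [Ioc_mem_nhdsGT (zero_lt_one (α := ℝ))] with t ht
  have := h t ht.1 ht.2
  rw [zero_add, smul_eq_mul, le_inv_mul_iff₀ ht.1]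
  exact this

section Convex

variable {E : Type*} [NormedAddCommGroup E] [InnerProductSpace ℝ E] [CompleteSpace E]

theorem hasDerivAt_along_segment {f : E → ℝ} {y : E} (hf : DifferentiableAt ℝ f y) (w : E) :
    HasDerivAt (fun t : ℝ => f (y + t • w)) (inner ℝ (gradient f y) w) 0 := by
  have h1 : HasDerivAt (fun t : ℝ => y + t • w) w 0 := by
    simpa using ((hasDerivAt_id (0 : ℝ)).smul_const w).const_add y
  have h2 : HasFDerivAt f (InnerProductSpace.toDual ℝ E (gradient f y)) (y + (0 : ℝ) • w) := by
    simpa using hf.hasGradientAt.hasFDerivAt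
  exact h2.comp_hasDerivAt (0 : ℝ) h1

theorem ConvexOn.add_inner_gradient_le {f : E → ℝ} (hc : ConvexOn ℝ Set.univ f) {y : E}
    (hf : DifferentiableAt ℝ f y) (z : E) : f y + inner ℝ (gradient f y) (z - y) ≤ f z := by
  have h := le_of_hasDerivAt_of_forall_mul_le (c := f y - f z)
    (hasDerivAt_along_segment hf (z - y)).neg (fun t ht0 ht1 => by
      have h1 := hc.2 (Set.mem_univ y) (Set.mem_univ z) (by linarith : 0 ≤ 1 - t) ht0.le (by ring)
      have h2 : (1 - t) • y + t • z = y + t • (z - y) := by module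
      rw [h2, smul_eq_mul, smul_eq_mul] at h1
      simp only [Pi.neg_apply, zero_smul, add_zero]
      linarith)
  linarith

theorem ConvexOn.inner_gradient_sub_nonneg {f : E → ℝ} (hc : ConvexOn ℝ Set.univ f)
    (hf : Differentiable ℝ f) (y z : E) :
    0 ≤ inner ℝ (gradient f y - gradient f z) (y - z) := by
  have h1 := hc.add_inner_gradient_le (hf y) z
  have h2 := hc.add_inner_gradient_le (hf z) y
  rw [← neg_sub y z, inner_neg_right] at h1
  rw [inner_sub_left]
  linarith

end Convex

section Extended

variable {n : ℕ} {f : Vec n → ℝ} {h : Vec n → EReal}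

theorem ProperClosedConvex.coe_toReal (hh : ProperClosedConvex h) {x : Vec n} (hx : h x ≠ ⊤) :
    ((h x).toReal : EReal) = h x :=
  EReal.coe_toReal hx (hh.ne_bot x)

theorem ProperClosedConvex.ne_top_of_mem_epsSubdifferential (hh : ProperClosedConvex h) {ε : ℝ}
    {y w : Vec n} (hw : w ∈ epsSubdifferential h ε y) : h y ≠ ⊤ := by
  obtain ⟨z, hz⟩ := hh.exists_ne_top
  intro hy
  have := hw z
  rw [hy, EReal.top_add_coe, top_le_iff] at this
  exact hz this

theorem ProperClosedConvex.toReal_add_le (hh : ProperClosedConvex h) {ε : ℝ} {y w z : Vec n}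
    (hw : w ∈ epsSubdifferential h ε y) (hz : h z ≠ ⊤) :
    (h y).toReal + (inner ℝ w (z - y) - ε) ≤ (h z).toReal := by
  have h1 := hw z
  rw [← hh.coe_toReal (hh.ne_top_of_mem_epsSubdifferential hw), ← hh.coe_toReal hz] at h1
  rw [real_inner_comm]
  exact_mod_cast h1

theorem IsOptimal.ne_top {xs : Vec n} (hopt : IsOptimal f h xs) (hh : ProperClosedConvex h) :
    h xs ≠ ⊤ := by
  obtain ⟨z, hz⟩ := hh.exists_ne_top
  intro hx
  have := hopt z
  rw [hx, EReal.coe_add_top, top_le_iff, ← hh.coe_toReal hz] at this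
  exact absurd (by exact_mod_cast this) (EReal.coe_ne_top (f z + (h z).toReal))

theorem IsOptimal.le_toReal {xs z : Vec n} (hopt : IsOptimal f h xs) (hh : ProperClosedConvex h)
    (hz : h z ≠ ⊤) : f xs + (h xs).toReal ≤ f z + (h z).toReal := by
  have h1 := hopt z
  rw [← hh.coe_toReal (hopt.ne_top hh), ← hh.coe_toReal hz] at h1
  exact_mod_cast h1

theorem ProperClosedConvex.toReal_segment_le (hh : ProperClosedConvex h) {x z : Vec n}
    (hx : h x ≠ ⊤) (hz : h z ≠ ⊤) {t : ℝ} (ht0 : 0 ≤ t) (ht1 : t ≤ 1) :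
    h (x + t • (z - x)) ≠ ⊤ ∧
      (h (x + t • (z - x))).toReal ≤ (1 - t) * (h x).toReal + t * (h z).toReal := by
  have h1 := hh.convex_epigraph (x := (x, (h x).toReal)) (y := (z, (h z).toReal))
    (hh.coe_toReal hx).ge (hh.coe_toReal hz).ge (by linarith : 0 ≤ 1 - t) ht0 (by ring)
  have h2 : (1 - t) • x + t • z = x + t • (z - x) := by module
  simp only [Set.mem_ofPred_eq, Prod.smul_mk, Prod.mk_add_mk, smul_eq_mul, h2] at h1
  have h3 : h (x + t • (z - x)) ≠ ⊤ := ne_top_of_le_ne_top (EReal.coe_ne_top _) h1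
  refine ⟨h3, ?_⟩
  rw [← hh.coe_toReal h3] at h1
  exact_mod_cast h1

/-- First-order optimality: `-∇f(x_*)` is a subgradient of `h` at a minimizer `x_*` of `f + h`. -/
theorem IsOptimal.toReal_sub_inner_gradient_le {xs z : Vec n} (hopt : IsOptimal f h xs)
    (hh : ProperClosedConvex h) (hf : DifferentiableAt ℝ f xs) (hz : h z ≠ ⊤) :
    (h xs).toReal - inner ℝ (gradient f xs) (z - xs) ≤ (h z).toReal := by
  have h1 := le_of_hasDerivAt_of_forall_mul_le (c := (h xs).toReal - (h z).toReal)
    (hasDerivAt_along_segment hf (z - xs)) (fun t ht0 ht1 => by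
      obtain ⟨h2, h3⟩ := hh.toReal_segment_le (hopt.ne_top hh) hz ht0.le ht1
      have h4 := hopt.le_toReal hh h2
      simp only [zero_smul, add_zero]
      linarith)
  linarith

end Extended

/-! ### Relative-error proximal steps -/

/-- The relative error alone is at most `s` times the step length. -/
theorem norm_le_of_sq_add_le {E : Type*} [NormedAddCommGroup E] {e a : E} {s q : ℝ} (hs : 0 ≤ s)
    (hq : 0 ≤ q) (h : ‖e‖ ^ 2 + q ≤ s ^ 2 * ‖a‖ ^ 2) : ‖e‖ ≤ s * ‖a‖ := by
  refine le_of_sq_le_sq ?_ (by positivity)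
  rw [mul_pow]
  linarith

section RelativeError

variable {E : Type*} [NormedAddCommGroup E] [InnerProductSpace ℝ E]

/-- Length of an inexact proximal step from `x`, in terms of the distance of `x` to a point `z`
at which the monotone operator takes the value `g`. -/
theorem sq_step_le_of_monotone {lam s ε : ℝ} {x y z u g : E} (hlam : 0 ≤ lam) (hs : 0 ≤ s)
    (hε : 0 ≤ ε) (h : ‖lam • u + y - x‖ ^ 2 + 2 * lam * ε ≤ s ^ 2 * ‖y - x‖ ^ 2)
    (hmono : -ε ≤ inner ℝ (u - g) (y - z)) :
    (1 - s ^ 2) / 2 * ‖y - x‖ ^ 2 ≤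
      (1 + s) * ‖y - x‖ * ‖x - z‖ + lam * ‖g‖ * (‖y - x‖ + ‖x - z‖) := by
  set e := lam • u + y - x with he
  set a := y - x with ha
  set b := x - z with hb
  have hq : 0 ≤ 2 * lam * ε := by positivity
  have hes : ‖e‖ ≤ s * ‖a‖ := norm_le_of_sq_add_le hs hq h
  have h1 : lam • (u - g) = e - a - lam • g := by
    rw [he, ha]; module
  have h2 : y - z = a + b := by rw [ha, hb]; abel
  have h3 : lam * inner ℝ (u - g) (y - z) = inner ℝ (e - a - lam • g) (a + b) := by
    rw [← h1, h2, real_inner_smul_left]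
  have h4 : -(lam * ε) ≤ inner ℝ (e - a - lam • g) (a + b) := by
    rw [← h3]
    linarith [mul_le_mul_of_nonneg_left hmono hlam]
  clear_value e a b
  rw [inner_add_right, inner_sub_left, inner_sub_left, inner_sub_left, inner_sub_left,
    real_inner_self_eq_norm_sq, real_inner_smul_left, real_inner_smul_left] at h4
  have h5 := real_inner_le_norm e a
  have h6 := real_inner_le_norm e b
  have h7 := neg_le_of_abs_le (abs_real_inner_le_norm a b)
  have h8 := mul_le_mul_of_nonneg_left (neg_le_of_abs_le (abs_real_inner_le_norm g a)) hlam
  have h9 := mul_le_mul_of_nonneg_left (neg_le_of_abs_le (abs_real_inner_le_norm g b)) hlam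
  have h10 : ‖e‖ * ‖b‖ ≤ s * ‖a‖ * ‖b‖ := mul_le_mul_of_nonneg_right hes (norm_nonneg b)
  have h11 := two_mul_le_add_sq ‖e‖ ‖a‖
  linarith

/-- An elementary step of `norm_sub_le_of_relative_errors`. -/
theorem mul_add_half_le_of_sq_add_le {p q s t : ℝ} (hp : p ≤ s) (hst : s ≤ t)
    (h : p ^ 2 + q ≤ s ^ 2) : p * t + q / 2 ≤ s * t := by
  nlinarith [mul_nonneg (sub_nonneg.2 hp) (sub_nonneg.2 hst)]

/-- Stability of inexact proximal steps: two steps, from `x₁` and `x₂` and with parameters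
`lam₁ ≤ lam₂`, differ by no more than their relative errors plus terms that are small with
`x₁ - x₂`, `lam₂ - lam₁` and the discrepancy `g` of the two monotone operators. -/
theorem norm_sub_le_of_relative_errors {lam₁ lam₂ s ε₁ ε₂ : ℝ} {x₁ x₂ y₁ y₂ u₁ u₂ g : E}
    (hlam₁ : 0 < lam₁) (hlam : lam₁ ≤ lam₂) (hs : 0 ≤ s) (hε₁ : 0 ≤ ε₁) (hε₂ : 0 ≤ ε₂)
    (h₁ : ‖lam₁ • u₁ + y₁ - x₁‖ ^ 2 + 2 * lam₁ * ε₁ ≤ s ^ 2 * ‖y₁ - x₁‖ ^ 2)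
    (h₂ : ‖lam₂ • u₂ + y₂ - x₂‖ ^ 2 + 2 * lam₂ * ε₂ ≤ s ^ 2 * ‖y₂ - x₂‖ ^ 2)
    (hmono : -(ε₁ + ε₂) ≤ inner ℝ (u₁ - u₂ + g) (y₁ - y₂)) :
    ‖y₁ - y₂‖ ≤ s * ‖y₁ - x₁‖ + s * ‖y₂ - x₂‖ +
      (‖x₁ - x₂‖ + (lam₂ - lam₁) / lam₂ * ((1 + s) * ‖y₂ - x₂‖) + lam₁ * ‖g‖) := by
  have hlam₂ : 0 < lam₂ := hlam₁.trans_le hlam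
  set e₁ := lam₁ • u₁ + y₁ - x₁ with he₁
  set e₂ := lam₂ • u₂ + y₂ - x₂ with he₂
  set θ := (lam₂ - lam₁) / lam₂ with hθ
  have hθ0 : 0 ≤ θ := div_nonneg (by linarith) hlam₂.le
  have hθlam : (1 - θ) * lam₂ = lam₁ := by rw [hθ]; field_simp; ring
  set r := x₂ - y₂ + e₂ with hr
  have hq₁ : 0 ≤ 2 * lam₁ * ε₁ := by positivity
  have hq₂ : 0 ≤ 2 * lam₂ * ε₂ := by positivity
  have hes₁ : ‖e₁‖ ≤ s * ‖y₁ - x₁‖ := norm_le_of_sq_add_le hs hq₁ h₁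
  have hes₂ : ‖e₂‖ ≤ s * ‖y₂ - x₂‖ := norm_le_of_sq_add_le hs hq₂ h₂
  have hrn : ‖r‖ ≤ (1 + s) * ‖y₂ - x₂‖ := by
    have := norm_add_le (x₂ - y₂) e₂
    rw [norm_sub_rev x₂ y₂] at this
    linarith
  have hvec : lam₁ • (u₁ - u₂ + g) =
      -(y₁ - y₂) + ((x₁ - x₂) + θ • r + lam₁ • g) + (e₁ - e₂) := by
    have h1 : lam₁ • u₂ = (1 - θ) • r := by
      rw [← hθlam, mul_smul, hr, he₂]
      congr 1
      abel
    rw [smul_add, smul_sub, h1, he₁, hr]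
    module
  have hmono' : -(lam₁ * ε₁ + lam₂ * ε₂) ≤
      inner ℝ (-(y₁ - y₂) + ((x₁ - x₂) + θ • r + lam₁ • g) + (e₁ - e₂)) (y₁ - y₂) := by
    rw [← hvec, real_inner_smul_left]
    have h1 := mul_le_mul_of_nonneg_left hmono hlam₁.le
    have h2 := mul_le_mul_of_nonneg_right hlam hε₂
    linarith
  set η := ‖x₁ - x₂‖ + θ * ((1 + s) * ‖y₂ - x₂‖) + lam₁ * ‖g‖ with hη
  set t := ‖y₁ - y₂‖ with ht
  have hηn : ‖(x₁ - x₂) + θ • r + lam₁ • g‖ ≤ η := by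
    refine (norm_add₃_le).trans ?_
    rw [norm_smul, norm_smul, Real.norm_of_nonneg hθ0, Real.norm_of_nonneg hlam₁.le, hη]
    gcongr
  have hη0 : 0 ≤ η := (norm_nonneg _).trans hηn
  rw [inner_add_left, inner_add_left, inner_neg_left, real_inner_self_eq_norm_sq,
    inner_sub_left] at hmono'
  have hi1 : inner ℝ ((x₁ - x₂) + θ • r + lam₁ • g) (y₁ - y₂) ≤ η * t :=
    (real_inner_le_norm _ _).trans (mul_le_mul_of_nonneg_right hηn (norm_nonneg _))
  have hi2 := real_inner_le_norm e₁ (y₁ - y₂)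
  have hi3 := neg_le_of_abs_le (abs_real_inner_le_norm e₂ (y₁ - y₂))
  by_contra! hcon
  have hs₁ : 0 ≤ s * ‖y₁ - x₁‖ := by positivity
  have hs₂ : 0 ≤ s * ‖y₂ - x₂‖ := by positivity
  have hk₁ := mul_add_half_le_of_sq_add_le (t := t) (q := 2 * lam₁ * ε₁) hes₁ (by linarith)
    (by rw [mul_pow]; exact h₁)
  have hk₂ := mul_add_half_le_of_sq_add_le (t := t) (q := 2 * lam₂ * ε₂) hes₂ (by linarith)
    (by rw [mul_pow]; exact h₂)
  have htpos : 0 < t := by linarith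
  have h3 : t * t ≤ (s * ‖y₁ - x₁‖ + s * ‖y₂ - x₂‖ + η) * t := by nlinarith
  exact absurd (le_of_mul_le_mul_right h3 htpos) (not_le.2 hcon)

theorem one_sub_mul_step_le_of_relative_errors {lam₁ lam₂ s ε₁ ε₂ : ℝ} {x₁ x₂ y₁ y₂ u₁ u₂ g : E}
    (hlam₁ : 0 < lam₁) (hlam : lam₁ ≤ lam₂) (hs : 0 ≤ s) (hε₁ : 0 ≤ ε₁) (hε₂ : 0 ≤ ε₂)
    (h₁ : ‖lam₁ • u₁ + y₁ - x₁‖ ^ 2 + 2 * lam₁ * ε₁ ≤ s ^ 2 * ‖y₁ - x₁‖ ^ 2)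
    (h₂ : ‖lam₂ • u₂ + y₂ - x₂‖ ^ 2 + 2 * lam₂ * ε₂ ≤ s ^ 2 * ‖y₂ - x₂‖ ^ 2)
    (hmono : -(ε₁ + ε₂) ≤ inner ℝ (u₁ - u₂ + g) (y₁ - y₂)) :
    (1 - s) * ‖y₂ - x₂‖ ≤ (1 + s) * ‖y₁ - x₁‖ +
      (2 * ‖x₁ - x₂‖ + (lam₂ - lam₁) / lam₂ * ((1 + s) * ‖y₂ - x₂‖) + lam₁ * ‖g‖) := by
  have h3 := norm_sub_le_of_relative_errors hlam₁ hlam hs hε₁ hε₂ h₁ h₂ hmono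
  have h4 : ‖y₂ - x₂‖ ≤ ‖y₁ - y₂‖ + ‖y₁ - x₁‖ + ‖x₁ - x₂‖ := by
    have : y₂ - x₂ = -(y₁ - y₂) + (y₁ - x₁) + (x₁ - x₂) := by abel
    rw [this]
    refine norm_add₃_le.trans ?_
    rw [norm_neg]
  linarith

end RelativeError

/-! ### Approximate solutions of the model problem -/

section ApproxSolution

variable {n : ℕ} {p : MethodInput} {f : Vec n → ℝ} {h : Vec n → EReal}

theorem IsApproxSolution.ne_top {d : ℕ} {M σ lam ε : ℝ} {x y u : Vec n}
    (hs : IsApproxSolution d M f h σ lam x y u ε) (hh : ProperClosedConvex h) : h y ≠ ⊤ := by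
  obtain ⟨w, hw, _⟩ := hs.inclusion
  exact hh.ne_top_of_mem_epsSubdifferential hw

theorem IsCompositeProblem.differentiable (hp : p.Admissible) (hF : IsCompositeProblem p f h) :
    Differentiable ℝ f :=
  hF.smooth.differentiable (by have := hp.one_le_d; exact_mod_cast (by omega : p.d ≠ 0))

/-- The residual vector is an `ε`-subgradient of `f + h`. -/
theorem IsApproxSolution.add_inner_residual_le (hp : p.Admissible) (hF : IsCompositeProblem p f h)
    {σ lam ε : ℝ} {x y u z : Vec n} (hs : IsApproxSolution p.d p.M f h σ lam x y u ε)
    (hz : h z ≠ ⊤) :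
    f y + (h y).toReal + inner ℝ (residualVector p.d p.M f x y u) (z - y) - ε
      ≤ f z + (h z).toReal := by
  obtain ⟨w, hw, rfl⟩ := hs.inclusion
  have h1 := hF.closed_convex.toReal_add_le hw hz
  have h2 := hF.convex.add_inner_gradient_le (hF.differentiable hp y) z
  have h3 : residualVector p.d p.M f x y (gradient (tensorModel p.d p.M f x) y + w)
      = gradient f y + w := by
    rw [residualVector]; abel
  rw [h3, inner_add_left]
  linarith

theorem IsApproxSolution.neg_eps_le_inner_residual (hp : p.Admissible)
    (hF : IsCompositeProblem p f h) {xs : Vec n} (hopt : IsOptimal f h xs)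
    {σ lam ε : ℝ} {x y u : Vec n} (hs : IsApproxSolution p.d p.M f h σ lam x y u ε) :
    -ε ≤ inner ℝ (residualVector p.d p.M f x y u) (y - xs) := by
  have h1 := hs.add_inner_residual_le hp hF (hopt.ne_top hF.closed_convex)
  have h2 := hopt.le_toReal hF.closed_convex (hs.ne_top hF.closed_convex)
  rw [← neg_sub y xs, inner_neg_right] at h1
  linarith

/-- At a minimizer `x_*` of `f + h`, the operator `∇f_x + ∂h` contains `∇f_x(x_*) - ∇f(x_*)`. -/
theorem IsApproxSolution.neg_eps_le_inner_model (hp : p.Admissible)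
    (hF : IsCompositeProblem p f h) {xs : Vec n} (hopt : IsOptimal f h xs)
    {σ lam ε : ℝ} {x y u : Vec n} (hs : IsApproxSolution p.d p.M f h σ lam x y u ε) :
    -ε ≤ inner ℝ (u - (gradient (tensorModel p.d p.M f x) xs - gradient f xs)) (y - xs) := by
  have hy := hs.ne_top hF.closed_convex
  obtain ⟨w, hw, rfl⟩ := hs.inclusion
  have h1 := hF.closed_convex.toReal_add_le hw (hopt.ne_top hF.closed_convex)
  have h2 := hopt.toReal_sub_inner_gradient_le hF.closed_convex (hF.differentiable hp xs) hy
  have h3 := (hF.model_convex x).inner_gradient_sub_nonneg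
    (differentiable_tensorModel hp.one_le_d hF.smooth p.M x) y xs
  rw [← neg_sub y xs, inner_neg_right] at h1
  have h4 : gradient (tensorModel p.d p.M f x) y + w
      - (gradient (tensorModel p.d p.M f x) xs - gradient f xs) =
      (gradient (tensorModel p.d p.M f x) y - gradient (tensorModel p.d p.M f x) xs)
        + w + gradient f xs := by abel
  rw [h4, inner_add_left, inner_add_left]
  linarith

theorem IsApproxSolution.neg_eps_le_inner_sub (hp : p.Admissible)
    (hF : IsCompositeProblem p f h) {σ lam₁ lam₂ ε₁ ε₂ : ℝ} {x₁ x₂ y₁ y₂ u₁ u₂ : Vec n}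
    (hs₁ : IsApproxSolution p.d p.M f h σ lam₁ x₁ y₁ u₁ ε₁)
    (hs₂ : IsApproxSolution p.d p.M f h σ lam₂ x₂ y₂ u₂ ε₂) :
    -(ε₁ + ε₂) ≤ inner ℝ (u₁ - u₂ + (gradient (tensorModel p.d p.M f x₂) y₂
      - gradient (tensorModel p.d p.M f x₁) y₂)) (y₁ - y₂) := by
  have hy₁ := hs₁.ne_top hF.closed_convex
  have hy₂ := hs₂.ne_top hF.closed_convex
  obtain ⟨w₁, hw₁, rfl⟩ := hs₁.inclusion
  obtain ⟨w₂, hw₂, rfl⟩ := hs₂.inclusion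
  have h1 := hF.closed_convex.toReal_add_le hw₁ hy₂
  have h2 := hF.closed_convex.toReal_add_le hw₂ hy₁
  have h3 := (hF.model_convex x₁).inner_gradient_sub_nonneg
    (differentiable_tensorModel hp.one_le_d hF.smooth p.M x₁) y₁ y₂
  rw [← neg_sub y₁ y₂, inner_neg_right] at h1
  have h4 : gradient (tensorModel p.d p.M f x₁) y₁ + w₁
      - (gradient (tensorModel p.d p.M f x₂) y₂ + w₂) + (gradient (tensorModel p.d p.M f x₂) y₂
      - gradient (tensorModel p.d p.M f x₁) y₂) =
      (gradient (tensorModel p.d p.M f x₁) y₁ - gradient (tensorModel p.d p.M f x₁) y₂)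
        + w₁ - w₂ := by abel
  rw [h4, inner_sub_left, inner_add_left]
  linarith

/-- If the step is not too large, the residual vector satisfies the relative error criterion for
`f + h` itself. -/
theorem IsApproxSolution.residual_error_le (hp : p.Admissible) (hF : IsCompositeProblem p f h)
    {lam ε : ℝ} {x y u : Vec n} (hs : IsApproxSolution p.d p.M f h p.sigmaHat lam x y u ε)
    (hstep : lam * ‖y - x‖ ^ (p.d - 1) ≤ p.alphaPlus) :
    ‖lam • residualVector p.d p.M f x y u + y - x‖ ^ 2 + 2 * lam * ε
      ≤ (p.sigmaHat + p.sigmaU) ^ 2 * ‖y - x‖ ^ 2 := by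
  have hlam := hs.lam_pos
  have hLM : 0 < p.L + p.M := by linarith [hp.L_nonneg, hp.M_pos]
  have hU : 0 < p.sigmaU := hp.sigmaL_pos.trans hp.sigmaL_lt_sigmaU
  have hfac : (0 : ℝ) < (p.d ! : ℝ) := by positivity
  have h1 := norm_gradient_sub_gradient_tensorModel_le hp.one_le_d hp.M_pos.le hF.smooth
    hF.lipschitz x y
  set e := lam • u + y - x with he
  set δ := gradient f y - gradient (tensorModel p.d p.M f x) y with hδ
  have h2 : lam * ‖δ‖ ≤ p.sigmaU * ‖y - x‖ := by
    have h3 : ‖y - x‖ ^ p.d = ‖y - x‖ ^ (p.d - 1) * ‖y - x‖ := by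
      rw [← pow_succ, Nat.sub_add_cancel hp.one_le_d]
    calc lam * ‖δ‖ ≤ lam * ((p.L + p.M) / (p.d ! : ℝ) * ‖y - x‖ ^ p.d) := by gcongr
      _ = (p.L + p.M) / (p.d ! : ℝ) * ((lam * ‖y - x‖ ^ (p.d - 1)) * ‖y - x‖) := by
          rw [h3]; ring
      _ ≤ (p.L + p.M) / (p.d ! : ℝ) * (p.alphaPlus * ‖y - x‖) := by gcongr
      _ = _ := by rw [MethodInput.alphaPlus]; field_simp
  have h4 : lam • residualVector p.d p.M f x y u + y - x = e + lam • δ := by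
    rw [residualVector, he, ← hδ]; module
  have hq : 0 ≤ 2 * lam * ε := by have := hs.eps_nonneg; positivity
  have h5 := hs.error_le
  rw [← he] at h5
  have h6 : ‖e‖ ≤ p.sigmaHat * ‖y - x‖ := norm_le_of_sq_add_le hp.sigmaHat_nonneg hq h5
  have h7 : ‖e + lam • δ‖ ≤ ‖e‖ + p.sigmaU * ‖y - x‖ := by
    refine (norm_add_le _ _).trans ?_
    rw [norm_smul, Real.norm_of_nonneg hlam.le]
    linarith
  have h8 : ‖e + lam • δ‖ ^ 2 ≤ (‖e‖ + p.sigmaU * ‖y - x‖) ^ 2 := by gcongr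
  have h9 : ‖e‖ * (p.sigmaU * ‖y - x‖) ≤ p.sigmaHat * ‖y - x‖ * (p.sigmaU * ‖y - x‖) := by gcongr
  rw [h4]
  linarith

end ApproxSolution

/-! ### Energy estimates for the outer method -/

section StepWeight

variable {A lam : ℝ}

theorem stepWeight_sq (hA : 0 ≤ A) (hlam : 0 < lam) :
    stepWeight A lam ^ 2 = lam * (A + stepWeight A lam) := by
  have h := Real.sq_sqrt (by positivity : 0 ≤ lam ^ 2 + 4 * lam * A)
  rw [stepWeight]
  linear_combination h / 4

theorem le_stepWeight (hA : 0 ≤ A) (hlam : 0 < lam) : lam ≤ stepWeight A lam := by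
  have h : lam ≤ √(lam ^ 2 + 4 * lam * A) := Real.le_sqrt_of_sq_le (by nlinarith)
  rw [stepWeight]
  linarith

end StepWeight

/-- One step of an accelerated hybrid proximal extragradient method, in terms of the values
`Φ, Φ', Φs` of the objective at `y`, `y'` and at the reference point `z`. -/
theorem energy_step_le {E : Type*} [NormedAddCommGroup E] [InnerProductSpace ℝ E]
    {A a lam σ ε Φ Φ' Φs : ℝ} {x y y' v xt z : E} (hA : 0 ≤ A) (ha : 0 < a) (hlam : 0 < lam)
    (hsq : a ^ 2 = lam * (A + a)) (hxt : (A + a) • xt = A • y + a • x)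
    (herr : ‖lam • v + y' - xt‖ ^ 2 + 2 * lam * ε ≤ σ ^ 2 * ‖y' - xt‖ ^ 2)
    (hz : Φ' + inner ℝ v (z - y') - ε ≤ Φs) (hy : A * (Φ' + inner ℝ v (y - y') - ε) ≤ A * Φ) :
    (A + a) * (Φ' - Φs) + ‖x - a • v - z‖ ^ 2 / 2
        + (1 - σ ^ 2) / 2 * ((A + a) / lam * ‖y' - xt‖ ^ 2)
      ≤ A * (Φ - Φs) + ‖x - z‖ ^ 2 / 2 := by
  have h1 : ‖x - a • v - z‖ ^ 2 = ‖x - z‖ ^ 2 - 2 * a * inner ℝ v (x - z) + a ^ 2 * ‖v‖ ^ 2 := by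
    have : x - a • v - z = (x - z) - a • v := by abel
    rw [this, norm_sub_sq_real, norm_smul, mul_pow, Real.norm_eq_abs, sq_abs, inner_smul_right,
      real_inner_comm]
    ring
  have h2 : ‖lam • v + y' - xt‖ ^ 2 =
      lam ^ 2 * ‖v‖ ^ 2 - 2 * lam * inner ℝ v (xt - y') + ‖y' - xt‖ ^ 2 := by
    have : lam • v + y' - xt = lam • v - (xt - y') := by abel
    rw [this, norm_sub_sq_real, norm_smul, mul_pow, Real.norm_eq_abs, sq_abs,
      real_inner_smul_left, norm_sub_rev xt y']
    ring
  have h3 : A * inner ℝ v (y - y') + a * inner ℝ v (z - y') =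
      (A + a) * inner ℝ v (xt - y') - a * inner ℝ v (x - z) := by
    rw [← real_inner_smul_right, ← real_inner_smul_right, ← real_inner_smul_right,
      ← real_inner_smul_right, ← inner_add_right, ← inner_sub_right, smul_sub (A + a), hxt]
    congr 1
    module
  rw [h2] at herr
  have h4 : (A + a) / lam * (lam ^ 2 * ‖v‖ ^ 2 - 2 * lam * inner ℝ v (xt - y') + ‖y' - xt‖ ^ 2
      + 2 * lam * ε) ≤ (A + a) / lam * (σ ^ 2 * ‖y' - xt‖ ^ 2) := by gcongr
  have h5 : (A + a) / lam * (lam ^ 2 * ‖v‖ ^ 2 - 2 * lam * inner ℝ v (xt - y') + ‖y' - xt‖ ^ 2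
      + 2 * lam * ε) = a ^ 2 * ‖v‖ ^ 2 - 2 * (A + a) * inner ℝ v (xt - y')
        + (A + a) / lam * ‖y' - xt‖ ^ 2 + 2 * (A + a) * ε := by
    rw [hsq]; field_simp
  rw [h5] at h4
  have h6 := mul_le_mul_of_nonneg_left hz ha.le
  rw [h1]
  linarith

section OuterMethod

variable {n : ℕ} {p : MethodInput} {f : Vec n → ℝ} {h : Vec n → EReal} {x₀ xs : Vec n}
  {rho epsTol D : ℝ} {k : ℕ} {s : OuterSequences n}

theorem smul_extrapolated {A lam : ℝ} (hA : 0 ≤ A) (hlam : 0 < lam) (x y : Vec n) :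
    (A + stepWeight A lam) • extrapolated A x y lam = A • y + stepWeight A lam • x := by
  have h1 : 0 < stepWeight A lam := hlam.trans_le (le_stepWeight hA hlam)
  have h2 : A + stepWeight A lam ≠ 0 := by positivity
  rw [extrapolated, smul_add, smul_smul, smul_smul, mul_div_cancel₀ _ h2, mul_div_cancel₀ _ h2]

namespace MethodInput

/-- The sum `σ = σ̂ + σ_u`, the relative error with which the accepted steps solve the proximal
subproblem of `f + h`. -/
def sigma (p : MethodInput) : ℝ := p.sigmaHat + p.sigmaU

/-- A bound for the weighted step lengths of the outer method. -/
noncomputable def stepBound (p : MethodInput) (D : ℝ) : ℝ := D / √(1 - p.sigma ^ 2)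

/-- A bound for the distance of the iterates of the outer method to a minimizer. -/
noncomputable def radius (p : MethodInput) (D : ℝ) : ℝ := D + p.stepBound D

/-- A positive lower bound for the `λ_j` of the outer method. -/
noncomputable def lamFloor (p : MethodInput) (D : ℝ) : ℝ :=
  p.alphaMinus / (2 * p.radius D + 1) ^ (p.d - 1)

variable {p : MethodInput}

theorem Admissible.L_add_M_pos (hp : p.Admissible) : 0 < p.L + p.M := by
  linarith [hp.L_nonneg, hp.M_pos]

theorem Admissible.alphaMinus_pos (hp : p.Admissible) : 0 < p.alphaMinus := by
  have := hp.L_add_M_pos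
  have := hp.sigmaL_pos
  rw [alphaMinus]
  positivity

theorem Admissible.alphaMinus_lt_alphaPlus (hp : p.Admissible) : p.alphaMinus < p.alphaPlus := by
  have := hp.L_add_M_pos
  have := hp.sigmaL_lt_sigmaU
  have hfac : (0 : ℝ) < (p.d ! : ℝ) := by positivity
  rw [alphaMinus, alphaPlus]
  gcongr

theorem Admissible.sigma_nonneg (hp : p.Admissible) : 0 ≤ p.sigma := by
  rw [sigma]
  linarith [hp.sigmaHat_nonneg, hp.sigmaL_pos, hp.sigmaL_lt_sigmaU]

theorem Admissible.one_sub_sigma_sq_pos (hp : p.Admissible) : 0 < 1 - p.sigma ^ 2 := by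
  have h1 := hp.sigma_nonneg
  have h2 : p.sigma < 1 := hp.sigma_lt_one
  nlinarith

theorem Admissible.stepBound_nonneg (_hp : p.Admissible) {D : ℝ} (hD : 0 ≤ D) :
    0 ≤ p.stepBound D :=
  div_nonneg hD (Real.sqrt_nonneg _)

theorem Admissible.stepBound_sq (hp : p.Admissible) (D : ℝ) :
    p.stepBound D ^ 2 * (1 - p.sigma ^ 2) = D ^ 2 := by
  have h1 := hp.one_sub_sigma_sq_pos
  rw [stepBound, div_pow, Real.sq_sqrt h1.le]
  field_simp

theorem Admissible.radius_nonneg (hp : p.Admissible) {D : ℝ} (hD : 0 ≤ D) : 0 ≤ p.radius D :=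
  add_nonneg hD (hp.stepBound_nonneg hD)

theorem Admissible.lamFloor_pos (hp : p.Admissible) {D : ℝ} (hD : 0 ≤ D) : 0 < p.lamFloor D := by
  have h1 := hp.radius_nonneg hD
  have h2 := hp.alphaMinus_pos
  rw [lamFloor]
  positivity

end MethodInput

/-- A relative-error step with residual vector or `ε` above `τ` cannot be short compared to
`lam`. -/
theorem lam_le_of_not_small {E : Type*} [NormedAddCommGroup E] [NormedSpace ℝ E]
    {lam σ ε τ : ℝ} {x y v : E} (hlam : 0 < lam) (hσ0 : 0 ≤ σ) (hσ1 : σ ≤ 1) (hε : 0 ≤ ε)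
    (herr : ‖lam • v + y - x‖ ^ 2 + 2 * lam * ε ≤ σ ^ 2 * ‖y - x‖ ^ 2)
    (hns : τ < ‖v‖ ∨ τ < ε) : lam * τ ≤ 2 * ‖y - x‖ ∨ lam * τ ≤ ‖y - x‖ ^ 2 := by
  have hq : 0 ≤ 2 * lam * ε := by positivity
  rcases hns with hv | he
  · left
    have h1 : ‖lam • v + y - x‖ ≤ σ * ‖y - x‖ := norm_le_of_sq_add_le hσ0 hq herr
    have h2 : ‖lam • v‖ ≤ ‖lam • v + y - x‖ + ‖y - x‖ := by
      have : lam • v = (lam • v + y - x) - (y - x) := by abel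
      conv_lhs => rw [this]
      exact norm_sub_le _ _
    rw [norm_smul, Real.norm_of_nonneg hlam.le] at h2
    have h3 : lam * τ ≤ lam * ‖v‖ := by gcongr
    have h4 : σ * ‖y - x‖ ≤ 1 * ‖y - x‖ := by gcongr
    linarith
  · right
    have h3 : lam * τ ≤ lam * ε := by gcongr
    have h4 : σ ^ 2 ≤ 1 := pow_le_one₀ hσ0 hσ1
    have h5 : σ ^ 2 * ‖y - x‖ ^ 2 ≤ 1 * ‖y - x‖ ^ 2 := by gcongr
    nlinarith [sq_nonneg ‖lam • v + y - x‖]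

/-- What the energy estimates give for the iterate number `j`. The disjunction takes care of `y₀`,
at which `h` may be infinite. -/
structure OuterInvariant (p : MethodInput) (f : Vec n → ℝ) (h : Vec n → EReal) (xs : Vec n) (D : ℝ)
    (s : OuterSequences n) (j : ℕ) : Prop where
  A_nonneg : 0 ≤ s.A j
  finite : s.A j = 0 ∨ h (s.y j) ≠ ⊤
  energy : s.A j * (f (s.y j) + (h (s.y j)).toReal - (f xs + (h xs).toReal))
    + ‖s.x j - xs‖ ^ 2 / 2 ≤ D ^ 2 / 2
  dist_y : ‖s.y j - xs‖ ≤ p.radius D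

theorem OuterInvariant.weighted_gap_nonneg (hF : IsCompositeProblem p f h)
    (hopt : IsOptimal f h xs) {j : ℕ} (hj : OuterInvariant p f h xs D s j) :
    0 ≤ s.A j * (f (s.y j) + (h (s.y j)).toReal - (f xs + (h xs).toReal)) := by
  rcases hj.finite with h0 | h0
  · rw [h0, zero_mul]
  · exact mul_nonneg hj.A_nonneg (sub_nonneg.2 (hopt.le_toReal hF.closed_convex h0))

theorem OuterInvariant.dist_x (hF : IsCompositeProblem p f h) (hopt : IsOptimal f h xs)
    (hD : 0 ≤ D) {j : ℕ} (hj : OuterInvariant p f h xs D s j) : ‖s.x j - xs‖ ≤ D := by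
  refine le_of_sq_le_sq ?_ hD
  linarith [hj.weighted_gap_nonneg hF hopt, hj.energy]

theorem IsOuterRun.step_mem (hrun : IsOuterRun p f h x₀ rho epsTol k s) {j : ℕ} (hj : j < k) :
    s.lam (j + 1) * ‖s.y (j + 1) - extrapolated (s.A j) (s.x j) (s.y j) (s.lam (j + 1))‖
        ^ (p.d - 1) ∈ Set.Icc p.alphaMinus p.alphaPlus :=
  (hrun.accept j hj).resolve_right (hrun.not_stopped (j + 1) (by omega) hj)

theorem IsOuterRun.step_error_le (hp : p.Admissible) (hF : IsCompositeProblem p f h)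
    (hrun : IsOuterRun p f h x₀ rho epsTol k s) {j : ℕ} (hj : j < k) :
    ‖s.lam (j + 1) • s.v (j + 1) + s.y (j + 1)
        - extrapolated (s.A j) (s.x j) (s.y j) (s.lam (j + 1))‖ ^ 2
        + 2 * s.lam (j + 1) * s.eps (j + 1)
      ≤ p.sigma ^ 2 * ‖s.y (j + 1) - extrapolated (s.A j) (s.x j) (s.y j) (s.lam (j + 1))‖ ^ 2 := by
  rw [hrun.v_succ j hj]
  exact (hrun.approx j hj).residual_error_le hp hF (hrun.step_mem hj).2

theorem IsOuterRun.energy_succ_le (hp : p.Admissible) (hF : IsCompositeProblem p f h)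
    (hopt : IsOptimal f h xs) (hrun : IsOuterRun p f h x₀ rho epsTol k s) {j : ℕ} (hj : j < k)
    (hinv : OuterInvariant p f h xs D s j) :
    s.A (j + 1) * (f (s.y (j + 1)) + (h (s.y (j + 1))).toReal - (f xs + (h xs).toReal))
      + ‖s.x (j + 1) - xs‖ ^ 2 / 2
      + (1 - p.sigma ^ 2) / 2 * (s.A (j + 1) / s.lam (j + 1) *
        ‖s.y (j + 1) - extrapolated (s.A j) (s.x j) (s.y j) (s.lam (j + 1))‖ ^ 2) ≤ D ^ 2 / 2 := by
  have hsol := hrun.approx j hj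
  have hlam := hsol.lam_pos
  have hA := hinv.A_nonneg
  have ha : 0 < stepWeight (s.A j) (s.lam (j + 1)) := hlam.trans_le (le_stepWeight hA hlam)
  have hz := hsol.add_inner_residual_le hp hF (hopt.ne_top hF.closed_convex)
  rw [← hrun.v_succ j hj] at hz
  rw [hrun.A_succ j hj, hrun.x_succ j hj]
  refine (energy_step_le hA ha hlam (stepWeight_sq hA hlam) (smul_extrapolated hA hlam _ _)
    (hrun.step_error_le hp hF hj) hz (Φ := f (s.y j) + (h (s.y j)).toReal) ?_).trans hinv.energy
  rcases hinv.finite with h0 | h0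
  · rw [h0, zero_mul, zero_mul]
  · have := hsol.add_inner_residual_le hp hF h0
    rw [← hrun.v_succ j hj] at this
    gcongr

theorem IsOuterRun.weighted_sq_step_le (hp : p.Admissible) (hF : IsCompositeProblem p f h)
    (hopt : IsOptimal f h xs) (hrun : IsOuterRun p f h x₀ rho epsTol k s) {j : ℕ} (hj : j < k)
    (hinv : OuterInvariant p f h xs D s j) :
    s.A (j + 1) * ‖s.y (j + 1) - extrapolated (s.A j) (s.x j) (s.y j) (s.lam (j + 1))‖ ^ 2
      ≤ p.stepBound D ^ 2 * s.lam (j + 1) := by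
  have hsol := hrun.approx j hj
  have hlam := hsol.lam_pos
  have hA := hinv.A_nonneg
  have hA' : 0 ≤ s.A (j + 1) := by
    rw [hrun.A_succ j hj]
    linarith [le_stepWeight hA hlam]
  have h1 := hrun.energy_succ_le hp hF hopt hj hinv
  have h2 := mul_nonneg hA' (sub_nonneg.2
    (hopt.le_toReal hF.closed_convex (hsol.ne_top hF.closed_convex)))
  have h3 := sq_nonneg ‖s.x (j + 1) - xs‖
  have h4 := hp.one_sub_sigma_sq_pos
  rw [← hp.stepBound_sq D] at h1
  have h5 : (1 - p.sigma ^ 2) * (s.A (j + 1) / s.lam (j + 1) *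
      ‖s.y (j + 1) - extrapolated (s.A j) (s.x j) (s.y j) (s.lam (j + 1))‖ ^ 2)
      ≤ (1 - p.sigma ^ 2) * p.stepBound D ^ 2 := by linarith
  have h6 := le_of_mul_le_mul_left h5 h4
  rwa [div_mul_eq_mul_div, div_le_iff₀ hlam] at h6

theorem IsOuterRun.weighted_step_le (hp : p.Admissible) (hF : IsCompositeProblem p f h)
    (hopt : IsOptimal f h xs) (hD : 0 ≤ D) (hrun : IsOuterRun p f h x₀ rho epsTol k s) {j : ℕ}
    (hj : j < k) (hinv : OuterInvariant p f h xs D s j) :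
    s.A (j + 1) * ‖s.y (j + 1) - extrapolated (s.A j) (s.x j) (s.y j) (s.lam (j + 1))‖
      ≤ stepWeight (s.A j) (s.lam (j + 1)) * p.stepBound D := by
  have hlam := (hrun.approx j hj).lam_pos
  have hA := hinv.A_nonneg
  have ha := hlam.trans_le (le_stepWeight hA hlam)
  have hA' : 0 ≤ s.A (j + 1) := by
    rw [hrun.A_succ j hj]
    linarith
  have h1 := mul_le_mul_of_nonneg_left (hrun.weighted_sq_step_le hp hF hopt hj hinv) hA'
  have h2 := stepWeight_sq hA hlam
  rw [← hrun.A_succ j hj] at h2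
  refine le_of_sq_le_sq ?_ (mul_nonneg ha.le (hp.stepBound_nonneg hD))
  rw [mul_pow, mul_pow, h2]
  linarith

theorem IsOuterRun.outerInvariant (hp : p.Admissible) (hF : IsCompositeProblem p f h)
    (hopt : IsOptimal f h xs) (hx₀ : ‖x₀ - xs‖ ≤ D)
    (hrun : IsOuterRun p f h x₀ rho epsTol k s) {j : ℕ} (hj : j ≤ k) :
    OuterInvariant p f h xs D s j := by
  have hD : 0 ≤ D := (norm_nonneg _).trans hx₀
  induction j with
  | zero =>
    refine ⟨hrun.A_zero.ge, Or.inl hrun.A_zero, ?_, ?_⟩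
    · rw [hrun.A_zero, hrun.x_zero, zero_mul, zero_add]
      gcongr
    · rw [hrun.y_zero, MethodInput.radius]
      linarith [hp.stepBound_nonneg hD]
  | succ j ih =>
    have hinv := ih (by omega)
    have hj' : j < k := hj
    have hsol := hrun.approx j hj'
    have hlam := hsol.lam_pos
    have hA := hinv.A_nonneg
    have ha := hlam.trans_le (le_stepWeight hA hlam)
    have hA' : 0 < s.A (j + 1) := by
      rw [hrun.A_succ j hj']
      linarith
    refine ⟨hA'.le, Or.inr (hsol.ne_top hF.closed_convex), ?_, ?_⟩
    · refine le_trans ?_ (hrun.energy_succ_le hp hF hopt hj' hinv)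
      have := hp.one_sub_sigma_sq_pos
      exact le_add_of_nonneg_right (by positivity)
    · have h1 : s.A (j + 1) • (s.y (j + 1) - xs) = s.A j • (s.y j - xs)
          + stepWeight (s.A j) (s.lam (j + 1)) • (s.x j - xs) + s.A (j + 1) •
            (s.y (j + 1) - extrapolated (s.A j) (s.x j) (s.y j) (s.lam (j + 1))) := by
        have := smul_extrapolated hA hlam (s.x j) (s.y j)
        rw [smul_sub _ (s.y (j + 1)) (extrapolated _ _ _ _), hrun.A_succ j hj', this]
        module
      have h2 := norm_add₃_le (a := s.A j • (s.y j - xs))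
        (b := stepWeight (s.A j) (s.lam (j + 1)) • (s.x j - xs)) (c := s.A (j + 1) •
            (s.y (j + 1) - extrapolated (s.A j) (s.x j) (s.y j) (s.lam (j + 1))))
      rw [← h1] at h2
      simp only [norm_smul, Real.norm_of_nonneg hA, Real.norm_of_nonneg hA'.le,
        Real.norm_of_nonneg ha.le] at h2
      have h3 := hrun.weighted_step_le hp hF hopt hD hj' hinv
      have h4 := mul_le_mul_of_nonneg_left (hinv.dist_x hF hopt hD) ha.le
      have h5 := mul_le_mul_of_nonneg_left hinv.dist_y hA
      refine le_of_mul_le_mul_left ?_ hA'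
      have h6 : s.A (j + 1) * p.radius D = s.A j * p.radius D
          + stepWeight (s.A j) (s.lam (j + 1)) * D
          + stepWeight (s.A j) (s.lam (j + 1)) * p.stepBound D := by
        rw [hrun.A_succ j hj', MethodInput.radius]
        ring
      linarith

theorem extrapolated_dist_le {A lam R : ℝ} (hA : 0 ≤ A) (hlam : 0 < lam) {x y z : Vec n}
    (hx : ‖x - z‖ ≤ R) (hy : ‖y - z‖ ≤ R) : ‖extrapolated A x y lam - z‖ ≤ R := by
  have ha := hlam.trans_le (le_stepWeight hA hlam)
  have h1 := (convex_closedBall z R) (x := y) (y := x) (by simpa [dist_eq_norm] using hy)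
    (by simpa [dist_eq_norm] using hx) (a := A / (A + stepWeight A lam))
    (b := stepWeight A lam / (A + stepWeight A lam)) (by positivity) (by positivity)
    (by rw [← add_div, div_self (by positivity)])
  simpa [dist_eq_norm, extrapolated] using h1

theorem IsOuterRun.lamFloor_le (hp : p.Admissible) (hF : IsCompositeProblem p f h)
    (hopt : IsOptimal f h xs) (hx₀ : ‖x₀ - xs‖ ≤ D)
    (hrun : IsOuterRun p f h x₀ rho epsTol k s) {j : ℕ} (hj : j < k) :
    p.lamFloor D ≤ s.lam (j + 1) := by
  have hD : 0 ≤ D := (norm_nonneg _).trans hx₀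
  have hinv := hrun.outerInvariant hp hF hopt hx₀ hj.le
  have hinv' := hrun.outerInvariant hp hF hopt hx₀ (Nat.succ_le_of_lt hj)
  have hlam := (hrun.approx j hj).lam_pos
  have hR := hp.radius_nonneg hD
  have hDR : D ≤ p.radius D := le_add_of_nonneg_right (hp.stepBound_nonneg hD)
  have h1 := extrapolated_dist_le hinv.A_nonneg hlam ((hinv.dist_x hF hopt hD).trans hDR)
    hinv.dist_y
  set xt := extrapolated (s.A j) (s.x j) (s.y j) (s.lam (j + 1)) with hxt
  have h2 : ‖s.y (j + 1) - xt‖ ≤ 2 * p.radius D + 1 := by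
    have : s.y (j + 1) - xt = (s.y (j + 1) - xs) - (xt - xs) := by abel
    rw [this]
    linarith [norm_sub_le (s.y (j + 1) - xs) (xt - xs), hinv'.dist_y]
  rw [MethodInput.lamFloor, div_le_iff₀ (by positivity)]
  refine (hrun.step_mem hj).1.trans ?_
  gcongr

theorem IsOuterRun.lamFloor_le_A (hp : p.Admissible) (hF : IsCompositeProblem p f h)
    (hopt : IsOptimal f h xs) (hx₀ : ‖x₀ - xs‖ ≤ D)
    (hrun : IsOuterRun p f h x₀ rho epsTol k s) (hk : 1 ≤ k) : p.lamFloor D ≤ s.A k := by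
  obtain ⟨j, rfl⟩ := Nat.exists_eq_add_of_le' hk
  have hj : j < j + 1 := Nat.lt_succ_self j
  have hinv := hrun.outerInvariant hp hF hopt hx₀ hj.le
  have h1 := hrun.lamFloor_le hp hF hopt hx₀ hj
  have h2 := le_stepWeight hinv.A_nonneg (hrun.approx j hj).lam_pos
  rw [hrun.A_succ j hj]
  linarith [hinv.A_nonneg]

/-- As long as the method has not stopped, `A_k` is at most polynomial in the inverse tolerances;
this is where the bound on the number of bisection steps becomes independent of `k`. -/
theorem IsOuterRun.A_mul_sq_le (hp : p.Admissible) (hF : IsCompositeProblem p f h)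
    (hopt : IsOptimal f h xs) (hx₀ : ‖x₀ - xs‖ ≤ D)
    (hrun : IsOuterRun p f h x₀ rho epsTol k s) (hk : 1 ≤ k) {τ : ℝ} (hτ0 : 0 < τ) (hτ1 : τ ≤ 1)
    (hτρ : τ ≤ rho) (hτε : τ ≤ epsTol) :
    s.A k * τ ^ 2 ≤ (4 / p.lamFloor D + 1) * p.stepBound D ^ 2 := by
  have hD : 0 ≤ D := (norm_nonneg _).trans hx₀
  have hfloor := hp.lamFloor_pos hD
  obtain ⟨j, rfl⟩ := Nat.exists_eq_add_of_le' hk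
  have hj : j < j + 1 := Nat.lt_succ_self j
  have hinv := hrun.outerInvariant hp hF hopt hx₀ hj.le
  have hA : 0 ≤ s.A (j + 1) := hfloor.le.trans (hrun.lamFloor_le_A hp hF hopt hx₀ hk)
  have h1 := hrun.lamFloor_le hp hF hopt hx₀ hj
  have h2 := hrun.weighted_sq_step_le hp hF hopt hj hinv
  have hsol := hrun.approx j hj
  have hlam := hsol.lam_pos
  have hns : τ < ‖s.v (j + 1)‖ ∨ τ < s.eps (j + 1) := by
    by_contra! hcon
    exact hrun.not_stopped (j + 1) (by omega) le_rfl ⟨hcon.1.trans hτρ, hcon.2.trans hτε⟩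
  have h3 := lam_le_of_not_small hlam hp.sigma_nonneg (hp.sigma_lt_one : p.sigma < 1).le
    hsol.eps_nonneg (hrun.step_error_le hp hF hj) hns
  set r := ‖s.y (j + 1) - extrapolated (s.A j) (s.x j) (s.y j) (s.lam (j + 1))‖ with hr
  set S := p.stepBound D with hS
  set lam := s.lam (j + 1) with hlamdef
  set A := s.A (j + 1) with hAdef
  have hSS : 0 ≤ S ^ 2 := sq_nonneg S
  rcases h3 with h4 | h4
  · -- `lam τ ≤ 2 r` gives `A lam² τ² ≤ 4 A r² ≤ 4 S² lam`
    have h5 : (lam * τ) ^ 2 ≤ (2 * r) ^ 2 := by gcongr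
    have h6 := mul_le_mul_of_nonneg_left h5 hA
    have h7 : lam * (A * τ ^ 2 * lam) ≤ lam * (4 * S ^ 2) := by linarith
    have h8 := le_of_mul_le_mul_left h7 hlam
    have h9 : A * τ ^ 2 * p.lamFloor D ≤ A * τ ^ 2 * lam := by gcongr
    have h10 : A * τ ^ 2 ≤ 4 * S ^ 2 / p.lamFloor D := by
      rw [le_div_iff₀ hfloor]; linarith
    calc A * τ ^ 2 ≤ 4 * S ^ 2 / p.lamFloor D := h10
      _ ≤ 4 * S ^ 2 / p.lamFloor D + S ^ 2 := by linarith
      _ = _ := by ring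
  · have h6 := mul_le_mul_of_nonneg_left h4 hA
    have h7 : lam * (A * τ) ≤ lam * S ^ 2 := by linarith
    have h8 := le_of_mul_le_mul_left h7 hlam
    have h9 : A * τ ^ 2 ≤ A * τ := by
      have : τ ^ 2 ≤ τ := by nlinarith
      gcongr
    have h10 : 0 ≤ 4 / p.lamFloor D * S ^ 2 := by positivity
    linarith

end OuterMethod

/-! ### Bounds for a single call of the subroutine -/

section SingleCall

namespace MethodInput

variable {p : MethodInput}

theorem Admissible.sigmaHat_lt_one (hp : p.Admissible) : p.sigmaHat < 1 := by
  linarith [hp.sigma_lt_one, hp.sigmaL_pos, hp.sigmaL_lt_sigmaU]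

/-- A bound for the step lengths of calls with `λ ‖y - x‖^(d-1) ≤ α₊`. -/
noncomputable def shortStepBound (p : MethodInput) (D : ℝ) : ℝ := 2 * p.radius D / (1 - p.sigma)

/-- The factor `c` of a bound `c (1 + λ)` for the step lengths of arbitrary calls. -/
noncomputable def stepFactor (p : MethodInput) (D : ℝ) : ℝ :=
  p.radius D + 2 * (p.radius D + (p.L + p.M) / (p.d ! : ℝ) * p.radius D ^ p.d)
    / ((1 - p.sigmaHat ^ 2) / 2)

/-- Calls with `λ` below this bound satisfy `λ ‖y - x‖^(d-1) ≤ α₊`. -/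
noncomputable def shortLam (p : MethodInput) (D : ℝ) : ℝ :=
  min 1 (p.alphaPlus / (2 * p.stepFactor D + 1) ^ (p.d - 1))

theorem Admissible.one_sub_sigmaHat_sq_pos (hp : p.Admissible) :
    0 < (1 - p.sigmaHat ^ 2) / 2 := by
  have h1 := hp.sigmaHat_nonneg
  have h2 := hp.sigmaHat_lt_one
  nlinarith

theorem Admissible.shortStepBound_nonneg (hp : p.Admissible) {D : ℝ} (hD : 0 ≤ D) :
    0 ≤ p.shortStepBound D := by
  have h1 : p.sigma < 1 := hp.sigma_lt_one
  have h2 := hp.radius_nonneg hD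
  exact div_nonneg (by positivity) (by linarith)

theorem Admissible.stepFactor_nonneg (hp : p.Admissible) {D : ℝ} (hD : 0 ≤ D) :
    0 ≤ p.stepFactor D := by
  have h1 := hp.radius_nonneg hD
  have h2 := hp.one_sub_sigmaHat_sq_pos
  have h3 := hp.L_add_M_pos
  rw [stepFactor]
  positivity

theorem Admissible.shortLam_pos (hp : p.Admissible) {D : ℝ} (hD : 0 ≤ D) : 0 < p.shortLam D := by
  have h1 := hp.stepFactor_nonneg hD
  have h2 := hp.alphaMinus_pos.trans hp.alphaMinus_lt_alphaPlus
  exact lt_min one_pos (by positivity)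

end MethodInput

variable {n : ℕ} {p : MethodInput} {f : Vec n → ℝ} {h : Vec n → EReal} {xs : Vec n}
  {D lam ε : ℝ} {x y u : Vec n}

theorem IsApproxSolution.step_le_shortStepBound (hp : p.Admissible)
    (hF : IsCompositeProblem p f h) (hopt : IsOptimal f h xs) (hD : 0 ≤ D)
    (hs : IsApproxSolution p.d p.M f h p.sigmaHat lam x y u ε) (hx : ‖x - xs‖ ≤ p.radius D)
    (hstep : lam * ‖y - x‖ ^ (p.d - 1) ≤ p.alphaPlus) : ‖y - x‖ ≤ p.shortStepBound D := by
  have hσ1 : p.sigma < 1 := hp.sigma_lt_one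
  have hσ0 := hp.sigma_nonneg
  have h1 := sq_step_le_of_monotone (g := 0) hs.lam_pos.le hp.sigma_nonneg hs.eps_nonneg
    (hs.residual_error_le hp hF hstep)
    (by rw [sub_zero]; exact hs.neg_eps_le_inner_residual hp hF hopt)
  rw [norm_zero, mul_zero, zero_mul, add_zero] at h1
  rcases (norm_nonneg (y - x)).eq_or_lt with h0 | h0
  · rw [← h0]
    exact hp.shortStepBound_nonneg hD
  · rw [MethodInput.shortStepBound, le_div_iff₀ (by linarith)]
    have h2 : (1 + p.sigma) * ‖y - x‖ * ‖x - xs‖ ≤ (1 + p.sigma) * ‖y - x‖ * p.radius D := by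
      gcongr
    have h3 : ((1 + p.sigma) / 2 * ‖y - x‖) * (‖y - x‖ * (1 - p.sigma)) ≤
        ((1 + p.sigma) / 2 * ‖y - x‖) * (2 * p.radius D) := by linarith
    exact le_of_mul_le_mul_left h3 (by positivity)

/-- A call with a short step and a residual that is not small has a bounded `λ`. -/
theorem IsApproxSolution.lam_mul_le_of_not_small (hp : p.Admissible)
    (hF : IsCompositeProblem p f h) (hopt : IsOptimal f h xs) (hD : 0 ≤ D)
    (hs : IsApproxSolution p.d p.M f h p.sigmaHat lam x y u ε) (hx : ‖x - xs‖ ≤ p.radius D)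
    (hstep : lam * ‖y - x‖ ^ (p.d - 1) ≤ p.alphaPlus) {τ : ℝ}
    (hns : τ < ‖residualVector p.d p.M f x y u‖ ∨ τ < ε) :
    lam * τ ≤ 2 * p.shortStepBound D + p.shortStepBound D ^ 2 := by
  have h1 := hs.step_le_shortStepBound hp hF hopt hD hx hstep
  have h0 := hp.shortStepBound_nonneg hD
  have h2 : ‖y - x‖ ^ 2 ≤ p.shortStepBound D ^ 2 := by gcongr
  have h3 := sq_nonneg (p.shortStepBound D)
  rcases lam_le_of_not_small hs.lam_pos hp.sigma_nonneg (hp.sigma_lt_one : p.sigma < 1).le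
    hs.eps_nonneg (hs.residual_error_le hp hF hstep) hns with h4 | h4 <;> linarith

theorem IsApproxSolution.step_le_stepFactor (hp : p.Admissible)
    (hF : IsCompositeProblem p f h) (hopt : IsOptimal f h xs) (hD : 0 ≤ D)
    (hs : IsApproxSolution p.d p.M f h p.sigmaHat lam x y u ε) (hx : ‖x - xs‖ ≤ p.radius D) :
    ‖y - x‖ ≤ p.stepFactor D * (1 + lam) := by
  have hR := hp.radius_nonneg hD
  have hκ := hp.one_sub_sigmaHat_sq_pos
  have hLM := hp.L_add_M_pos
  have hlam := hs.lam_pos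
  have hs0 := hp.sigmaHat_nonneg
  have hs1 := hp.sigmaHat_lt_one
  set κ := (1 - p.sigmaHat ^ 2) / 2 with hκdef
  set G := (p.L + p.M) / (p.d ! : ℝ) * p.radius D ^ p.d with hG
  have hG0 : 0 ≤ G := by positivity
  have hg : ‖gradient (tensorModel p.d p.M f x) xs - gradient f xs‖ ≤ G := by
    rw [norm_sub_rev]
    refine (norm_gradient_sub_gradient_tensorModel_le hp.one_le_d hp.M_pos.le hF.smooth
      hF.lipschitz x xs).trans ?_
    rw [norm_sub_rev xs x, hG]
    gcongr
  have h1 := sq_step_le_of_monotone hs.lam_pos.le hp.sigmaHat_nonneg hs.eps_nonneg hs.error_le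
    (hs.neg_eps_le_inner_model hp hF hopt)
  rw [← hκdef] at h1
  have hfac : p.stepFactor D = p.radius D + 2 * (p.radius D + G) / κ := rfl
  rcases le_or_gt ‖y - x‖ (p.radius D) with h2 | h2
  · refine h2.trans ?_
    have h3 : p.radius D ≤ p.stepFactor D := by
      rw [hfac]
      exact le_add_of_nonneg_right (by positivity)
    calc p.radius D ≤ p.stepFactor D * 1 := by rwa [mul_one]
      _ ≤ _ := by
        have := hp.stepFactor_nonneg hD
        gcongr
        linarith
  · have h0 : 0 < ‖y - x‖ := hR.trans_lt h2
    have h3 : (1 + p.sigmaHat) * ‖y - x‖ * ‖x - xs‖ ≤ 2 * ‖y - x‖ * p.radius D := by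
      gcongr
      linarith
    have h4 : lam * ‖gradient (tensorModel p.d p.M f x) xs - gradient f xs‖
        * (‖y - x‖ + ‖x - xs‖) ≤ lam * G * (‖y - x‖ + ‖y - x‖) := by
      gcongr
      exact hx.trans h2.le
    have h5 : ‖y - x‖ * (κ * ‖y - x‖) ≤ ‖y - x‖ * (2 * p.radius D + 2 * lam * G) := by
      linarith
    have h6 := le_of_mul_le_mul_left h5 h0
    have h7 : ‖y - x‖ ≤ (2 * p.radius D + 2 * lam * G) / κ := by
      rw [le_div_iff₀ hκ]; linarith
    refine h7.trans ?_
    have h8 : (2 * p.radius D + 2 * lam * G) / κ ≤ 2 * (p.radius D + G) / κ * (1 + lam) := by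
      rw [div_mul_eq_mul_div]
      gcongr
      have : 0 ≤ p.radius D * lam := by positivity
      linarith
    have h9 : 0 ≤ p.radius D * (1 + lam) := by positivity
    rw [hfac]
    linarith

theorem IsApproxSolution.shortLam_lt (hp : p.Admissible)
    (hF : IsCompositeProblem p f h) (hopt : IsOptimal f h xs) (hD : 0 ≤ D)
    (hs : IsApproxSolution p.d p.M f h p.sigmaHat lam x y u ε) (hx : ‖x - xs‖ ≤ p.radius D)
    (hstep : p.alphaPlus < lam * ‖y - x‖ ^ (p.d - 1)) : p.shortLam D < lam := by
  by_contra! hcon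
  have h0 := hp.stepFactor_nonneg hD
  have hlam := hs.lam_pos
  have h1 : lam ≤ 1 := hcon.trans (min_le_left _ _)
  have h2 : ‖y - x‖ ≤ 2 * p.stepFactor D + 1 := by
    refine (hs.step_le_stepFactor hp hF hopt hD hx).trans ?_
    nlinarith
  have h3 := hcon.trans (min_le_right _ _)
  rw [le_div_iff₀ (by positivity)] at h3
  refine absurd (hstep.trans_le (le_trans ?_ h3)) (lt_irrefl _)
  gcongr

theorem IsApproxSolution.one_sub_mul_step_le (hp : p.Admissible) (hF : IsCompositeProblem p f h)
    {lam₁ lam₂ ε₁ ε₂ : ℝ} {x₁ x₂ y₁ y₂ u₁ u₂ : Vec n} (hlam : lam₁ ≤ lam₂)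
    (hs₁ : IsApproxSolution p.d p.M f h p.sigmaHat lam₁ x₁ y₁ u₁ ε₁)
    (hs₂ : IsApproxSolution p.d p.M f h p.sigmaHat lam₂ x₂ y₂ u₂ ε₂) (hx : ‖x₁ - x₂‖ ≤ 1) :
    (1 - p.sigmaHat) * ‖y₂ - x₂‖ ≤ (1 + p.sigmaHat) * ‖y₁ - x₁‖ +
      (2 * ‖x₁ - x₂‖ + (lam₂ - lam₁) / lam₂ * ((1 + p.sigmaHat) * ‖y₂ - x₂‖)
        + lam₁ * ((p.L + p.d * p.M) * ‖x₁ - x₂‖ * (1 + ‖y₂ - x₂‖) ^ (p.d - 1))) := by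
  refine (one_sub_mul_step_le_of_relative_errors hs₁.lam_pos hlam hp.sigmaHat_nonneg
    hs₁.eps_nonneg hs₂.eps_nonneg hs₁.error_le hs₂.error_le
    (hs₁.neg_eps_le_inner_sub hp hF hs₂)).trans ?_
  have h1 := hs₁.lam_pos
  gcongr
  rw [norm_sub_rev]
  exact norm_gradient_tensorModel_sub_le hp.one_le_d hp.L_nonneg hp.M_pos.le hF.smooth
    hF.lipschitz hx le_rfl

end SingleCall

/-! ### A bracket of the bisection cannot be short -/

section Bracket

/-- The parameter `λ_β = A β² / (1 - β)`. -/
noncomputable def bisectionLam (A β : ℝ) : ℝ := A * (β ^ 2 / (1 - β))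

theorem bisectionLam_sub {A β₁ β₂ : ℝ} (h₁ : β₁ < 1) (h₂ : β₂ < 1) :
    bisectionLam A β₂ - bisectionLam A β₁ =
      A * ((β₂ - β₁) * (1 / ((1 - β₁) * (1 - β₂)) - 1)) := by
  have h₁' : 1 - β₁ ≠ 0 := by linarith
  have h₂' : 1 - β₂ ≠ 0 := by linarith
  rw [bisectionLam, bisectionLam]
  field_simp
  ring

theorem one_le_pow_mul_one_sub_of_bisectionLam_le {W A β : ℝ} (hW : 2 ≤ W) (hβ0 : 0 ≤ β)
    (hβ1 : β < 1) (hA : 1 ≤ W * A) (hlam : bisectionLam A β ≤ W) : 1 ≤ W ^ 4 * (1 - β) := by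
  have hW2 : 4 ≤ W ^ 2 := by nlinarith
  have hW4 : W ^ 4 = W ^ 2 * W ^ 2 := by ring
  have hβ : 0 < 1 - β := by linarith
  rcases le_or_gt β (1 / 2) with h | h
  · nlinarith
  · rw [bisectionLam, ← mul_div_assoc, div_le_iff₀ hβ] at hlam
    have h1 : 1 / 4 ≤ β ^ 2 := by nlinarith
    have h2 : W * (A * β ^ 2) ≤ W * (W * (1 - β)) := by gcongr
    have h3 : 1 * (1 / 4) ≤ (W * A) * β ^ 2 := by gcongr
    have h4 : 1 ≤ 4 * (W ^ 2 * (1 - β)) := by linarith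
    calc 1 ≤ 4 * (W ^ 2 * (1 - β)) := h4
      _ ≤ W ^ 2 * (W ^ 2 * (1 - β)) := by gcongr
      _ = _ := by ring

theorem pow_sub_pow_le_of_le_add {a b ζ Q : ℝ} {m : ℕ} (ha : 0 ≤ a) (hb : 0 ≤ b) (hζ : 0 ≤ ζ)
    (hab : a ≤ b + ζ) (haQ : a ≤ Q) (hQ : 1 ≤ Q) : a ^ m - b ^ m ≤ m * Q ^ m * ζ := by
  rcases le_or_gt a b with h | h
  · have h1 : a ^ m ≤ b ^ m := by gcongr
    have h2 : 0 ≤ m * Q ^ m * ζ := by positivity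
    linarith
  · have h1 := (le_abs_self _).trans (abs_pow_sub_pow_le a b m)
    rw [abs_of_nonneg (sub_nonneg.2 h.le), abs_of_nonneg ha, abs_of_nonneg hb,
      max_eq_left h.le] at h1
    have h2 : a ^ (m - 1) ≤ Q ^ m :=
      (pow_le_pow_left₀ ha haQ _).trans (pow_le_pow_right₀ hQ (Nat.sub_le _ _))
    calc a ^ m - b ^ m ≤ (a - b) * m * a ^ (m - 1) := h1
      _ ≤ ζ * m * Q ^ m := by gcongr; linarith
      _ = _ := by ring

/-- The quantitative gap. All quantities that occur in comparing the two ends of a bracket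
are at most powers of `W`, so that the two step criteria differ by at most a power of `W` times
the length `η` of the bracket; but they have to differ by the positive amount `γ`. -/
theorem one_lt_mul_pow_of_criteria {m : ℕ} {W η lam₁ lam₂ s r₁ r₂ δ αm αp c : ℝ}
    (hW : 2 ≤ W) (hη : 0 ≤ η) (hs0 : 0 ≤ s) (hs1 : s < 1) (hr₁ : 0 ≤ r₁) (hr₂ : 0 ≤ r₂)
    (hδ0 : 0 ≤ δ) (hc0 : 0 ≤ c) (hc : c ≤ W)
    (hlam₁ : 0 < lam₁) (hlam : lam₁ ≤ lam₂) (hlam₁W : lam₁ ≤ W) (hlam₂W : lam₂ ≤ W ^ 7)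
    (hlamη : lam₂ - lam₁ ≤ η * W ^ 11) (hlam₂ : 1 ≤ W * lam₂) (hr₂W : r₂ ≤ W * (1 + lam₂))
    (hδ : δ ≤ W * η) (hγ : 1 ≤ W * (αp * (1 - s) ^ m - αm * (1 + s) ^ m))
    (hlow : lam₁ * r₁ ^ m < αm) (hhigh : αp < lam₂ * r₂ ^ m)
    (hcmp : (1 - s) * r₂ ≤ (1 + s) * r₁ + (2 * δ + (lam₂ - lam₁) / lam₂ * ((1 + s) * r₂)
      + lam₁ * (c * δ * (1 + r₂) ^ m))) :
    1 < η * W ^ (20 * m + 27) := by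
  have hW0 : 0 < W := by linarith
  have hW1 : 1 ≤ W := by linarith
  have hlam₂0 : 0 < lam₂ := hlam₁.trans_le hlam
  have hone : ∀ i : ℕ, 1 ≤ W ^ i := fun i => one_le_pow₀ hW1
  have hr₂' : r₂ ≤ W ^ 9 := by
    calc r₂ ≤ W * (1 + lam₂) := hr₂W
      _ ≤ W * (W ^ 7 + W ^ 7) := by gcongr; exact hone 7
      _ = 2 * W ^ 8 := by ring
      _ ≤ W * W ^ 8 := by gcongr
      _ = W ^ 9 := by ring
  have h1r : 1 + r₂ ≤ W ^ 10 := by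
    calc 1 + r₂ ≤ W ^ 9 + W ^ 9 := by gcongr; exact hone 9
      _ = 2 * W ^ 9 := by ring
      _ ≤ W * W ^ 9 := by gcongr
      _ = W ^ 10 := by ring
  set ζ := 2 * δ + (lam₂ - lam₁) / lam₂ * ((1 + s) * r₂) + lam₁ * (c * δ * (1 + r₂) ^ m) with hζ
  have hθ0 : 0 ≤ (lam₂ - lam₁) / lam₂ := div_nonneg (by linarith) hlam₂0.le
  have hζ0 : 0 ≤ ζ := by positivity
  have hζW : ζ ≤ η * W ^ (10 * m + 24) := by
    have h1 : 2 * δ ≤ η * W ^ (10 * m + 22) := by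
      calc 2 * δ ≤ W * (W * η) := by gcongr
        _ = η * W ^ 2 := by ring
        _ ≤ _ := by gcongr; omega
    have h2 : (lam₂ - lam₁) / lam₂ * ((1 + s) * r₂) ≤ η * W ^ (10 * m + 22) := by
      have h3 : (lam₂ - lam₁) / lam₂ ≤ η * W ^ 11 * W := by
        rw [div_le_iff₀ hlam₂0]
        calc lam₂ - lam₁ ≤ η * W ^ 11 * 1 := by rwa [mul_one]
          _ ≤ η * W ^ 11 * (W * lam₂) := by gcongr
          _ = _ := by ring
      calc _ ≤ η * W ^ 11 * W * (W * W ^ 9) := by gcongr; linarith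
        _ = η * W ^ 22 := by ring
        _ ≤ _ := by gcongr; omega
    have h4 : lam₁ * (c * δ * (1 + r₂) ^ m) ≤ η * W ^ (10 * m + 22) := by
      calc _ ≤ W * (W * (W * η) * (W ^ 10) ^ m) := by gcongr
        _ = η * W ^ (10 * m + 3) := by rw [← pow_mul]; ring
        _ ≤ _ := by gcongr; omega
    calc ζ ≤ η * W ^ (10 * m + 22) + η * W ^ (10 * m + 22) + η * W ^ (10 * m + 22) := by
          rw [hζ]; gcongr
      _ = 3 * (η * W ^ (10 * m + 22)) := by ring
      _ ≤ W ^ 2 * (η * W ^ (10 * m + 22)) := by gcongr; nlinarith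
      _ = _ := by ring
  set a := (1 - s) * r₂ with ha
  set b := (1 + s) * r₁ with hb
  have ha0 : 0 ≤ a := mul_nonneg (by linarith) hr₂
  have hb0 : 0 ≤ b := by positivity
  have haW : a ≤ W ^ 9 := by
    refine le_trans ?_ hr₂'
    rw [ha]
    nlinarith
  have hdiff := pow_sub_pow_le_of_le_add (m := m) ha0 hb0 hζ0 hcmp haW (hone 9)
  have hgap : αp * (1 - s) ^ m - αm * (1 + s) ^ m < lam₂ * a ^ m - lam₁ * b ^ m := by
    rw [ha, hb, mul_pow, mul_pow]
    have h1 : 0 < (1 - s) ^ m := pow_pos (by linarith) m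
    have h2 : 0 < (1 + s) ^ m := by positivity
    have h3 := mul_lt_mul_of_pos_right hhigh h1
    have h4 := mul_lt_mul_of_pos_right hlow h2
    linarith
  have hm : (m : ℝ) ≤ W ^ m := by
    calc (m : ℝ) ≤ 2 ^ m := by exact_mod_cast (Nat.lt_two_pow_self).le
      _ ≤ W ^ m := by gcongr
  have hup : lam₂ * a ^ m - lam₁ * b ^ m ≤ η * W ^ (20 * m + 26) := by
    have h1 : (lam₂ - lam₁) * a ^ m ≤ η * W ^ (20 * m + 25) := by
      calc _ ≤ η * W ^ 11 * (W ^ 9) ^ m := by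
            gcongr
        _ = η * W ^ (9 * m + 11) := by rw [← pow_mul]; ring
        _ ≤ _ := by gcongr <;> omega
    have h2 : lam₁ * (a ^ m - b ^ m) ≤ η * W ^ (20 * m + 25) := by
      calc _ ≤ lam₁ * (m * (W ^ 9) ^ m * ζ) := by gcongr
        _ ≤ W * (W ^ m * (W ^ 9) ^ m * (η * W ^ (10 * m + 24))) := by gcongr
        _ = η * W ^ (20 * m + 25) := by rw [← pow_mul]; ring
    calc lam₂ * a ^ m - lam₁ * b ^ m = (lam₂ - lam₁) * a ^ m + lam₁ * (a ^ m - b ^ m) := by ring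
      _ ≤ 2 * (η * W ^ (20 * m + 25)) := by linarith
      _ ≤ W * (η * W ^ (20 * m + 25)) := by gcongr
      _ = _ := by ring
  calc 1 ≤ W * (αp * (1 - s) ^ m - αm * (1 + s) ^ m) := hγ
    _ < W * (lam₂ * a ^ m - lam₁ * b ^ m) := by gcongr
    _ ≤ W * (η * W ^ (20 * m + 26)) := by gcongr
    _ = η * W ^ (20 * m + 27) := by ring

end Bracket

/-! ### The bisection -/

section Bisection

variable {n : ℕ} {p : MethodInput} {f : Vec n → ℝ} {h : Vec n → EReal} {xs : Vec n}
  {ats : ℝ → Vec n → SubroutineOutput n} {A D rho epsTol : ℝ} {x y : Vec n}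

/-- The quantity `λ ‖y - x‖^(d-1)` tested by the bisection. -/
noncomputable def Trial.criterion (p : MethodInput) (t : Trial n) : ℝ :=
  t.lam * ‖t.y - t.x‖ ^ (p.d - 1)

/-- The trial meets both tolerances. -/
def Trial.IsSmall (rho epsTol : ℝ) (t : Trial n) : Prop := ‖t.v‖ ≤ rho ∧ t.eps ≤ epsTol

/-- What is known about the state of the bisection after `N` steps: a bracket has length `2^(-N)`,
and each of its ends is either an end of `[0, 1]` or a trial that failed on the corresponding
side. -/
def BisectionState.Reachable (p : MethodInput) (f : Vec n → ℝ)
    (ats : ℝ → Vec n → SubroutineOutput n) (A : ℝ) (x y : Vec n) (rho epsTol : ℝ) (N : ℕ) :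
    BisectionState n → Prop
  | .searching βm βp =>
      0 ≤ βm ∧ βp ≤ 1 ∧ βp - βm = (1 / 2) ^ N ∧
      (βm = 0 ∨ 0 < βm ∧ βm < 1 ∧ ¬ (trial p f ats A x y βm).IsSmall rho epsTol ∧
        (trial p f ats A x y βm).criterion p < p.alphaMinus) ∧
      (βp = 1 ∨ 0 < βp ∧ βp < 1 ∧ ¬ (trial p f ats A x y βp).IsSmall rho epsTol ∧
        p.alphaPlus < (trial p f ats A x y βp).criterion p)
  | .smallResidual t => ∃ β, 0 < β ∧ β < 1 ∧ t = trial p f ats A x y β ∧ t.IsSmall rho epsTol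
  | .largeStep t => ∃ β, 0 < β ∧ β < 1 ∧ t = trial p f ats A x y β ∧
      t.criterion p ∈ Set.Icc p.alphaMinus p.alphaPlus

theorem reachable_bisection (p : MethodInput) (f : Vec n → ℝ)
    (ats : ℝ → Vec n → SubroutineOutput n) (A : ℝ) (x y : Vec n) (rho epsTol : ℝ) (N : ℕ) :
    (bisection p f ats A x y rho epsTol N).Reachable p f ats A x y rho epsTol N := by
  induction N with
  | zero => simp [bisection, BisectionState.Reachable]
  | succ N ih =>
    rw [bisection, Function.iterate_succ_apply', ← bisection]
    generalize bisection p f ats A x y rho epsTol N = st at ih ⊢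
    cases st with
    | smallResidual t => exact ih
    | largeStep t => exact ih
    | searching βm βp =>
      obtain ⟨h0, h1, hlen, hm, hp⟩ := ih
      have hpos : (0 : ℝ) < (1 / 2) ^ N := by positivity
      have hβ0 : 0 < (βm + βp) / 2 := by linarith
      have hβ1 : (βm + βp) / 2 < 1 := by linarith
      have hhalf : ((1 : ℝ) / 2) ^ (N + 1) = (1 / 2) ^ N / 2 := by ring
      simp only [bisectionStep]
      split_ifs with hsmall hmem hlarge
      · exact ⟨_, hβ0, hβ1, rfl, hsmall⟩
      · exact ⟨_, hβ0, hβ1, rfl, hmem⟩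
      · exact ⟨h0, hβ1.le, by rw [hhalf]; linarith, hm, Or.inr ⟨hβ0, hβ1, hsmall, hlarge⟩⟩
      · refine ⟨hβ0.le, h1, by rw [hhalf]; linarith, Or.inr ⟨hβ0, hβ1, hsmall, ?_⟩, hp⟩
        by_contra! hcon
        exact hmem ⟨hcon, not_lt.1 hlarge⟩

theorem bisectionLam_pos (hA : 0 < A) {β : ℝ} (hβ0 : 0 < β) (hβ1 : β < 1) :
    0 < bisectionLam A β := by
  have : 0 < 1 - β := by linarith
  rw [bisectionLam]
  positivity

theorem IsSubroutine.isApproxSolution_trial (hats : IsSubroutine p f h ats) (hA : 0 < A) {β : ℝ}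
    (hβ0 : 0 < β) (hβ1 : β < 1) (x y : Vec n) :
    IsApproxSolution p.d p.M f h p.sigmaHat (bisectionLam A β) (trial p f ats A x y β).x
      (trial p f ats A x y β).y (trial p f ats A x y β).u (trial p f ats A x y β).eps :=
  hats _ _ (bisectionLam_pos hA hβ0 hβ1)

theorem stepWeight_bisectionLam (hA : 0 < A) {β : ℝ} (hβ0 : 0 < β) (hβ1 : β < 1) :
    stepWeight A (bisectionLam A β) = A * β / (1 - β) := by
  have hβ : 0 < 1 - β := by linarith
  have h2 : 0 < 2 - β := by linarith
  have h1 : bisectionLam A β ^ 2 + 4 * bisectionLam A β * A = (A * β * (2 - β) / (1 - β)) ^ 2 := by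
    rw [bisectionLam]
    field_simp
    ring
  rw [stepWeight, h1, Real.sqrt_sq (by positivity), bisectionLam]
  field_simp
  ring

theorem extrapolated_bisectionLam (hA : 0 < A) {β : ℝ} (hβ0 : 0 < β) (hβ1 : β < 1)
    (x y : Vec n) : extrapolated A x y (bisectionLam A β) = (1 - β) • y + β • x := by
  have hβ : 1 - β ≠ 0 := by linarith
  have h1 : A + A * β / (1 - β) = A / (1 - β) := by field_simp; ring
  rw [extrapolated, stepWeight_bisectionLam hA hβ0 hβ1, h1]
  congr 2 <;> field_simp

theorem IsSubroutine.isValid_trial (hats : IsSubroutine p f h ats) (hA : 0 < A) {β : ℝ}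
    (hβ0 : 0 < β) (hβ1 : β < 1) (x y : Vec n) :
    (trial p f ats A x y β).IsValid p f h A x y ∧
      extrapolated A x y (trial p f ats A x y β).lam = (trial p f ats A x y β).x := by
  have h1 : extrapolated A x y (trial p f ats A x y β).lam = (trial p f ats A x y β).x :=
    extrapolated_bisectionLam hA hβ0 hβ1 x y
  refine ⟨⟨?_, ?_⟩, h1⟩
  · rw [h1]
    exact hats.isApproxSolution_trial hA hβ0 hβ1 x y
  · rw [h1]
    rfl

namespace MethodInput

/-- The margin between the two step criteria that remains after accounting for the relative
errors. -/
noncomputable def margin (p : MethodInput) : ℝ :=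
  p.alphaPlus * (1 - p.sigmaHat) ^ (p.d - 1) - p.alphaMinus * (1 + p.sigmaHat) ^ (p.d - 1)

theorem Admissible.margin_pos {p : MethodInput} (hp : p.Admissible) : 0 < p.margin := by
  have h1 := hp.L_add_M_pos
  have h2 : (0 : ℝ) < (p.d ! : ℝ) / (p.L + p.M) := by positivity
  have h3 := mul_lt_mul_of_pos_left hp.gap h2
  rw [margin, alphaPlus, alphaMinus, sub_pos]
  calc _ = (p.d ! : ℝ) / (p.L + p.M) * (p.sigmaL * (1 + p.sigmaHat) ^ (p.d - 1)) := by ring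
    _ < _ := h3
    _ = _ := by ring

/-- All constants of the problem are dominated by the scale `W`; the tolerances enter through
`τ`. -/
structure Scale (p : MethodInput) (D τ A W : ℝ) : Prop where
  two_le : 2 ≤ W
  one_le_A : 1 ≤ W * A
  A_le : A ≤ W ^ 2
  short_le : 2 * p.shortStepBound D + p.shortStepBound D ^ 2 ≤ W * τ
  one_le_shortLam : 1 ≤ W * p.shortLam D
  stepFactor_le : p.stepFactor D ≤ W
  radius_le : 2 * p.radius D ≤ W
  lipschitz_le : p.L + p.d * p.M ≤ W
  one_le_margin : 1 ≤ W * p.margin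

end MethodInput

theorem trial_x_dist_le {R β : ℝ} (hx : ‖x - xs‖ ≤ R) (hy : ‖y - xs‖ ≤ R) (hβ0 : 0 < β)
    (hβ1 : β < 1) : ‖(trial p f ats A x y β).x - xs‖ ≤ R := by
  have h1 := (convex_closedBall xs R) (x := y) (y := x) (by simpa [dist_eq_norm] using hy)
    (by simpa [dist_eq_norm] using hx) (a := 1 - β) (b := β) (by linarith) hβ0.le (by ring)
  simpa [dist_eq_norm, trial] using h1

/-- A bracket of the bisection is not shorter than a fixed power of the scale: its upper end stays
away from `0` and its lower end from `1`, and in between the two step criteria are far apart. -/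
theorem one_lt_bracket_mul_pow (hp : p.Admissible) (hF : IsCompositeProblem p f h)
    (hopt : IsOptimal f h xs) (hD : 0 ≤ D) (hats : IsSubroutine p f h ats) (hA : 0 < A)
    (hx : ‖x - xs‖ ≤ p.radius D) (hy : ‖y - xs‖ ≤ p.radius D) {τ W : ℝ} (hτ : 0 < τ)
    (hτρ : τ ≤ rho) (hτε : τ ≤ epsTol) (hW : p.Scale D τ A W) {N : ℕ} {βm βp : ℝ}
    (hst : (BisectionState.searching βm βp : BisectionState n).Reachable p f ats A x y rho epsTol
      N) :
    1 < (1 / 2) ^ N * W ^ (20 * (p.d - 1) + 27) := by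
  obtain ⟨hβm0, hβp1, hlen, hm, hpl⟩ := hst
  set q := 20 * (p.d - 1) + 27 with hq
  set η : ℝ := (1 / 2) ^ N with hη
  have hη0 : 0 < η := by positivity
  have h2W := hW.two_le
  have hW0 : 0 < W := by linarith
  have hW1 : 1 ≤ W := by linarith
  by_contra! hcon
  have hη5 : η * W ^ 5 ≤ 1 := by
    refine le_trans ?_ hcon
    have : W ^ 5 ≤ W ^ q := pow_le_pow_right₀ hW1 (by omega)
    gcongr
  have hβm1 : βm < 1 := by linarith
  -- the lower end of the bracket stays away from `1`
  have hlamW : bisectionLam A βm ≤ W := by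
    rcases hm with rfl | ⟨h0, h1, hns, hcrit⟩
    · simpa [bisectionLam] using hW0.le
    · have hs := hats.isApproxSolution_trial hA h0 h1 x y
      have h2 := hs.lam_mul_le_of_not_small hp hF hopt hD (trial_x_dist_le hx hy h0 h1)
        (hcrit.le.trans hp.alphaMinus_lt_alphaPlus.le) (τ := τ) (by
          by_contra! hcon'
          exact hns ⟨hcon'.1.trans hτρ, hcon'.2.trans hτε⟩)
      exact le_of_mul_le_mul_right (h2.trans hW.short_le) hτ
  have h4 := one_le_pow_mul_one_sub_of_bisectionLam_le h2W hβm0 hβm1 hW.one_le_A hlamW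
  have h5 : 1 ≤ W ^ 5 * (1 - βp) := by
    have h6 : 2 * 1 ≤ W * (W ^ 4 * (1 - βm)) := by gcongr
    have h7 : W ^ 5 * (1 - βp) = W * (W ^ 4 * (1 - βm)) - η * W ^ 5 := by
      rw [← hlen]; ring
    linarith
  have hβp1' : 0 < 1 - βp := by
    by_contra! hneg
    have := mul_nonpos_of_nonneg_of_nonpos (by positivity : 0 ≤ W ^ 5) hneg
    linarith
  obtain ⟨hp0, hp1, -, hhigh⟩ := hpl.resolve_left (by linarith)
  have hsp := hats.isApproxSolution_trial hA hp0 hp1 x y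
  have hxp : ‖(trial p f ats A x y βp).x - xs‖ ≤ p.radius D := trial_x_dist_le hx hy hp0 hp1
  have hinv : 1 / (1 - βp) ≤ W ^ 5 := by rwa [div_le_iff₀ hβp1']
  have hlamp : 1 ≤ W * bisectionLam A βp := by
    refine hW.one_le_shortLam.trans ?_
    have := (hsp.shortLam_lt hp hF hopt hD hxp hhigh).le
    gcongr
  -- the upper end of the bracket stays away from `0`
  have hm' : βm ≠ 0 := by
    rintro rfl
    have h6 : βp = η := by linarith
    have h7 : bisectionLam A βp ≤ W ^ 2 * (η ^ 2 * W ^ 5) := by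
      rw [bisectionLam, div_eq_mul_one_div, ← h6]
      have := hW.A_le
      gcongr
    have h8 : W * bisectionLam A βp ≤ W * (W ^ 2 * (η ^ 2 * W ^ 5)) := by gcongr
    have h9 : η * W ^ 4 * 2 ≤ 1 := by
      calc η * W ^ 4 * 2 ≤ η * W ^ 4 * W := by gcongr
        _ = η * W ^ 5 := by ring
        _ ≤ 1 := hη5
    have h10 : 0 ≤ η * W ^ 4 := by positivity
    have h11 : (η * W ^ 4) ^ 2 ≤ (1 / 2) ^ 2 := by gcongr; linarith
    have h12 : W * (W ^ 2 * (η ^ 2 * W ^ 5)) = (η * W ^ 4) ^ 2 := by ring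
    rw [h12] at h8
    linarith
  obtain ⟨hm0, hm1, -, hlow⟩ := hm.resolve_left hm'
  have hsm := hats.isApproxSolution_trial hA hm0 hm1 x y
  have hprod : 1 ≤ 1 / ((1 - βm) * (1 - βp)) := by
    rw [le_div_iff₀ (mul_pos (by linarith) hβp1')]
    nlinarith
  have hdiff := bisectionLam_sub (A := A) hm1 hp1
  rw [hlen] at hdiff
  have hlam : bisectionLam A βm ≤ bisectionLam A βp := by
    have : 0 ≤ A * (η * (1 / ((1 - βm) * (1 - βp)) - 1)) :=
      mul_nonneg hA.le (mul_nonneg hη0.le (by linarith))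
    linarith
  have hlamη : bisectionLam A βp - bisectionLam A βm ≤ η * W ^ 11 := by
    have h6 : 1 / (1 - βm) ≤ W ^ 4 := by rwa [div_le_iff₀ (by linarith)]
    have h7 : 1 / ((1 - βm) * (1 - βp)) ≤ W ^ 4 * W ^ 5 := by
      have : 0 < 1 - βm := by linarith
      rw [one_div, mul_inv, ← one_div, ← one_div]
      gcongr
    rw [hdiff]
    have := hW.A_le
    calc A * (η * (1 / ((1 - βm) * (1 - βp)) - 1)) ≤ W ^ 2 * (η * (W ^ 4 * W ^ 5)) := by
          gcongr; linarith
      _ = _ := by ring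
  have hlampW : bisectionLam A βp ≤ W ^ 7 := by
    have h6 : βp ^ 2 ≤ 1 := pow_le_one₀ hp0.le hp1.le
    have := hW.A_le
    calc bisectionLam A βp = A * (βp ^ 2 * (1 / (1 - βp))) := by
          rw [bisectionLam, div_eq_mul_one_div]
      _ ≤ W ^ 2 * (1 * W ^ 5) := by gcongr
      _ = _ := by ring
  have hδ : ‖(trial p f ats A x y βm).x - (trial p f ats A x y βp).x‖ ≤ W * η := by
    have h6 : (trial p f ats A x y βm).x - (trial p f ats A x y βp).x = (βp - βm) • (y - x) := by
      simp only [trial]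
      module
    rw [h6, hlen, norm_smul, Real.norm_of_nonneg hη0.le, mul_comm]
    have h7 : ‖y - x‖ ≤ W := by
      have : y - x = (y - xs) - (x - xs) := by abel
      rw [this]
      linarith [norm_sub_le (y - xs) (x - xs), hW.radius_le]
    gcongr
  have hδ1 : W * η ≤ 1 := by
    refine le_trans ?_ hη5
    have : W ^ 1 ≤ W ^ 5 := pow_le_pow_right₀ hW1 (by norm_num)
    rw [mul_comm]
    gcongr
    simpa using this
  have hcmp := IsApproxSolution.one_sub_mul_step_le hp hF hlam hsm hsp (hδ.trans hδ1)
  have hstep := hsp.step_le_stepFactor hp hF hopt hD hxp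
  have hsp0 := hsp.lam_pos
  refine absurd hcon (not_le.2 (one_lt_mul_pow_of_criteria h2W hη0.le hp.sigmaHat_nonneg
    hp.sigmaHat_lt_one (norm_nonneg _) (norm_nonneg _) (norm_nonneg _) ?_ hW.lipschitz_le
    hsm.lam_pos hlam hlamW hlampW hlamη hlamp (hstep.trans ?_) hδ hW.one_le_margin hlow hhigh
    hcmp))
  · have := hp.L_nonneg
    have := hp.M_pos
    positivity
  · have := hW.stepFactor_le
    gcongr

end Bisection

/-! ### Choice of the scale -/

theorem MethodInput.Admissible.exists_scale {p : MethodInput} (hp : p.Admissible) {D : ℝ}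
    (hD : 0 ≤ D) : ∃ κ : ℕ, ∀ A τ : ℝ, 0 < τ → τ ≤ 1 → p.lamFloor D ≤ A →
      A * τ ^ 2 ≤ (4 / p.lamFloor D + 1) * p.stepBound D ^ 2 → p.Scale D τ A (2 ^ κ / τ) := by
  have h1 := hp.lamFloor_pos hD
  have h2 := hp.stepBound_nonneg hD
  have h3 := hp.shortStepBound_nonneg hD
  have h4 := hp.shortLam_pos hD
  have h5 := hp.stepFactor_nonneg hD
  have h6 := hp.radius_nonneg hD
  have h7 := hp.margin_pos
  have h8 := hp.L_nonneg
  have h9 := hp.M_pos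
  set c₁ := 1 / p.lamFloor D with hc₁
  set c₂ := (4 / p.lamFloor D + 1) * p.stepBound D ^ 2 with hc₂
  set c₃ := 2 * p.shortStepBound D + p.shortStepBound D ^ 2 with hc₃
  set c₄ := 1 / p.shortLam D with hc₄
  set c₅ := p.L + p.d * p.M with hc₅
  set c₆ := 1 / p.margin with hc₆
  have p₁ : 0 ≤ c₁ := by positivity
  have p₂ : 0 ≤ c₂ := by positivity
  have p₃ : 0 ≤ c₃ := by positivity
  have p₄ : 0 ≤ c₄ := by positivity
  have p₅ : 0 ≤ c₅ := by positivity
  have p₆ : 0 ≤ c₆ := by positivity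
  obtain ⟨κ, hκ⟩ := pow_unbounded_of_one_lt
    (2 + c₁ + c₂ + c₃ + c₄ + p.stepFactor D + 2 * p.radius D + c₅ + c₆) (one_lt_two (α := ℝ))
  refine ⟨κ, fun A τ hτ0 hτ1 hA hAτ => ?_⟩
  set K : ℝ := 2 ^ κ with hK
  have hK0 : 0 < K := by positivity
  have hKW : K ≤ K / τ := le_div_self hK0.le hτ0 hτ1
  have hinv : ∀ {c W : ℝ}, 0 < c → 1 / c ≤ W → 1 ≤ W * c := fun hc hW => by
    rwa [div_le_iff₀ hc] at hW
  refine ⟨by linarith, ?_, ?_, ?_, hinv h4 (by linarith), by linarith, by linarith, by linarith,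
    hinv h7 (by linarith)⟩
  · refine (hinv h1 (by linarith : 1 / p.lamFloor D ≤ K / τ)).trans ?_
    gcongr
  · rw [div_pow, le_div_iff₀ (by positivity)]
    nlinarith
  · rw [div_mul_cancel₀ _ hτ0.ne']
    linarith

theorem theorem4p1 (p : MethodInput) (hp : p.Admissible) (D B : ℝ) :
    ∃ C : ℝ, 0 < C ∧
      ∀ (n : ℕ) (f : Vec n → ℝ) (h : Vec n → EReal) (x₀ xs : Vec n),
        IsCompositeProblem p f h →
        IsOptimal f h xs → ‖x₀ - xs‖ ≤ D →
        (∀ l, 2 ≤ l → l ≤ p.d → ‖iteratedFDeriv ℝ l f xs‖ ≤ B) →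
      ∀ (rho epsTol : ℝ), 0 < rho → 0 < epsTol →
      ∀ (ats : ℝ → Vec n → SubroutineOutput n), IsSubroutine p f h ats →
      ∀ (k : ℕ) (s : OuterSequences n), 1 ≤ k → IsOuterRun p f h x₀ rho epsTol k s →
        ∃ N : ℕ,
          (N : ℝ) ≤ C * max 1 (max (Real.logb 2 epsTol⁻¹) (Real.logb 2 rho⁻¹)) ∧
          ((∃ t : Trial n,
              bisection p f ats (s.A k) (s.x k) (s.y k) rho epsTol N = .largeStep t ∧
              t.IsValid p f h (s.A k) (s.x k) (s.y k) ∧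
              p.alphaMinus ≤
                t.lam * ‖extrapolated (s.A k) (s.x k) (s.y k) t.lam - t.y‖ ^ (p.d - 1) ∧
              t.lam * ‖extrapolated (s.A k) (s.x k) (s.y k) t.lam - t.y‖ ^ (p.d - 1)
                ≤ p.alphaPlus) ∨
           (∃ t : Trial n,
              bisection p f ats (s.A k) (s.x k) (s.y k) rho epsTol N = .smallResidual t ∧
              t.IsValid p f h (s.A k) (s.x k) (s.y k) ∧
              ‖t.v‖ ≤ rho ∧ t.eps ≤ epsTol)) := by
  rcases lt_or_ge D 0 with hD | hD
  · -- a negative `D` bounds no norm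
    refine ⟨1, one_pos, fun n f h x₀ xs _ _ hx₀ => ?_⟩
    exact absurd (hx₀.trans_lt hD) (not_lt.2 (norm_nonneg _))
  obtain ⟨κ, hκ⟩ := hp.exists_scale hD
  set q := 20 * (p.d - 1) + 27 with hq
  refine ⟨q * (κ + 1) + 1, by positivity, ?_⟩
  intro n f h x₀ xs hF hopt hx₀ _ rho epsTol hrho hepsTol ats hats k s hk hrun
  set μ := max 1 (max (Real.logb 2 epsTol⁻¹) (Real.logb 2 rho⁻¹)) with hμ
  have hμ1 : 1 ≤ μ := le_max_left _ _
  -- `τ = min (1/2) (min epsTol rho)`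
  have hτ_le : ∀ {c : ℝ}, 0 < c → Real.logb 2 c⁻¹ ≤ μ → (2 : ℝ) ^ (-μ) ≤ c := by
    intro c hc hle
    rw [Real.logb_inv] at hle
    rw [← Real.le_logb_iff_rpow_le one_lt_two hc]
    linarith
  have hτρ : (2 : ℝ) ^ (-μ) ≤ rho :=
    hτ_le hrho ((le_max_right _ _).trans (le_max_right _ _))
  have hτε : (2 : ℝ) ^ (-μ) ≤ epsTol :=
    hτ_le hepsTol ((le_max_left _ _).trans (le_max_right _ _))
  have hτ0 : (0 : ℝ) < 2 ^ (-μ) := by positivity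
  have hτ1 : (2 : ℝ) ^ (-μ) ≤ 1 := Real.rpow_le_one_of_one_le_of_nonpos one_le_two (by linarith)
  have hfloor := hrun.lamFloor_le_A hp hF hopt hx₀ hk
  have hA : 0 < s.A k := (hp.lamFloor_pos hD).trans_le hfloor
  have hscale := hκ (s.A k) _ hτ0 hτ1 hfloor
    (hrun.A_mul_sq_le hp hF hopt hx₀ hk hτ0 hτ1 hτρ hτε)
  have hinv := hrun.outerInvariant hp hF hopt hx₀ le_rfl
  have hx : ‖s.x k - xs‖ ≤ p.radius D :=
    (hinv.dist_x hF hopt hD).trans (le_add_of_nonneg_right (hp.stepBound_nonneg hD))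
  refine ⟨⌈q * (κ + μ)⌉₊, ?_, ?_⟩
  · refine (Nat.ceil_lt_add_one (by positivity)).le.trans ?_
    have h1 : (q * κ : ℝ) * 1 ≤ q * κ * μ := by gcongr
    linarith
  have hreach := reachable_bisection p f ats (s.A k) (s.x k) (s.y k) rho epsTol ⌈q * (κ + μ)⌉₊
  cases hst : bisection p f ats (s.A k) (s.x k) (s.y k) rho epsTol ⌈q * (κ + μ)⌉₊ with
  | searching βm βp =>
    rw [hst] at hreach
    have h1 := one_lt_bracket_mul_pow hp hF hopt hD hats hA hx hinv.dist_y hτ0 hτρ hτε hscale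
      hreach
    refine absurd h1 (not_lt.2 ?_)
    have h2 : ((2 : ℝ) ^ κ / 2 ^ (-μ)) ^ q = 2 ^ (q * (κ + μ) : ℝ) := by
      rw [← Real.rpow_natCast 2 κ, ← Real.rpow_sub two_pos, ← Real.rpow_mul_natCast two_pos.le]
      congr 1
      ring
    rw [h2, one_div, inv_pow, inv_mul_le_one₀ (by positivity), ← Real.rpow_natCast]
    exact Real.rpow_le_rpow_of_exponent_le one_le_two (Nat.le_ceil _)
  | smallResidual t =>
    rw [hst] at hreach
    obtain ⟨β, hβ0, hβ1, rfl, hsmall⟩ := hreach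
    exact Or.inr ⟨_, rfl, (hats.isValid_trial hA hβ0 hβ1 _ _).1, hsmall⟩
  | largeStep t =>
    rw [hst] at hreach
    obtain ⟨β, hβ0, hβ1, rfl, hmem⟩ := hreach
    obtain ⟨hvalid, hext⟩ := hats.isValid_trial (f := f) hA hβ0 hβ1 (s.x k) (s.y k)
    refine Or.inl ⟨_, rfl, hvalid, ?_⟩
    rw [hext, norm_sub_rev]
    exact hmem
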